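/- Conventions. A \emph{numbering} is a partial recursive function $(e,\sigma)\mapsto\varphi_e(\sigma)$, where $e\in\omega$ and $\sigma$ ranges over finite binary strings. A number $X\in[0,1]$ is \emph{left-r.e.} if $X=\sum_{\sigma\in\operatorname{dom}\varphi_e}2^{-|\sigma|}$ for some numbering $\varphi$ and some $e$. A \emph{left-r.e. numbering} of a class $\mathcal C$ of left-r.e. reals is a map $e\mapsto\sum_{\sigma\in\operatorname{dom}\varphi_e}2^{-|\sigma|}$ with range $\mathcal C$, for some numbering $\varphi$; it is \emph{universal} if $\mathcal C$ is the class of all left-r.e. reals. A left-r.e. numbering $\alpha$ is \emph{acceptable} if for every left-r.e. numbering $\beta$ there is a recursive $f$ with $\alpha_{f(e)}=\beta_e$ for all $e$. A real is \emph{finite} if its binary expansion has only finitely many $1$'s or only finitely many $0$'s (i.e. it is a dyadic rational). An infinite set of natural numbers is \emph{immune} if it has no infinite recursive subset; an infinite set $\{a_0<a_1<\cdots\}$ is \emph{hyperimmune} if there is no recursive $f$ with $f(n)>a_n$ for all $n$; a set is \emph{bi-immune} (\emph{bi-hyperimmune}) if it and its complement are both immune (hyperimmune). A real in $[0,1]$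 has one of these properties if the set of positions of the $1$'s in its binary expansion has it (for dyadic rationals, which have two expansions, none of the properties holds for either). A set is $\Pi_3$-\emph{complete} if it is $\Pi^0_3$ and every $\Pi^0_3$ set of natural numbers many-one reduces to it. Theorem. Let $\alpha$ be an acceptable universal left-r.e. numbering. (a) For every $\Sigma^0_3$ set $A\subseteq\omega$ there is a recursive function $g:\omega\to\omega$ such that for all $x$, \[ x\in A\implies \alpha_{g(x)}\text{ is finite},\qquad x\notin A\implies \alpha_{g(x)}\text{ is bi-hyperimmune}. \] (b) Each of the four index sets $\{e:\alpha_e\text{ is immune}\}$, $\{e:\alpha_e\text{ is hyperimmune}\}$, $\{e:\alpha_e\text{ is bi-immune}\}$ and $\{e:\alpha_e\text{ is bi-hyperimmune}\}$ is $\Pi_3$-complete. -/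

import Mathlib

namespace LeftRE

/-- A numbering: a partial recursive function `(e, σ) ↦ φ_e(σ)`, with programs `φ_e` acting on
finite binary strings. -/
def IsNumbering (φ : ℕ → List Bool →. ℕ) : Prop :=
  Partrec₂ φ

/-- The number `X` is the sum of `2 ^ (-|σ|)` over all strings `σ` in the domain of `ψ`. -/
def HasWeight (ψ : List Bool →. ℕ) (X : ℝ) : Prop :=
  HasSum (fun σ : {σ : List Bool // (ψ σ).Dom} => (2⁻¹ : ℝ) ^ σ.1.length) X

/-- The left-r.e. reals, as numbers in `[0, 1]`. -/
def IsLeftRE (X : ℝ) : Prop :=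
  X ∈ Set.Icc (0 : ℝ) 1 ∧ ∃ φ : ℕ → List Bool →. ℕ, IsNumbering φ ∧ ∃ e, HasWeight (φ e) X

/-- `α` is a left-r.e. numbering of the class `C` of left-r.e. reals. -/
def IsLeftRENumberingOf (C : Set ℝ) (α : ℕ → ℝ) : Prop :=
  (∀ X ∈ C, IsLeftRE X) ∧ Set.range α = C ∧
    ∃ φ : ℕ → List Bool →. ℕ, IsNumbering φ ∧ ∀ e, HasWeight (φ e) (α e)

/-- A universal left-r.e. numbering: a left-r.e. numbering of all left-r.e. reals. -/
def IsUniversal (α : ℕ → ℝ) : Prop :=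
  IsLeftRENumberingOf {X | IsLeftRE X} α

/-- Every left-r.e. numbering (of any class) translates recursively into `α`. -/
def IsAcceptable (α : ℕ → ℝ) : Prop :=
  ∀ (C : Set ℝ) (β : ℕ → ℝ), IsLeftRENumberingOf C β →
    ∃ f : ℕ → ℕ, Computable f ∧ ∀ e, α (f e) = β e

/-- An infinite set with no infinite recursive subset. -/
def Immune (S : Set ℕ) : Prop :=
  S.Infinite ∧ ¬ ∃ R : Set ℕ, R ⊆ S ∧ R.Infinite ∧ ComputablePred (fun n => n ∈ R)

/-- An infinite set `S = {a₀ < a₁ < ⋯}` such that no recursive `f` satisfies `f n > aₙ` for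
all `n`. -/
def Hyperimmune (S : Set ℕ) : Prop :=
  S.Infinite ∧ ¬ ∃ f : ℕ → ℕ, Computable f ∧ ∀ n, Nat.nth (fun k => k ∈ S) n < f n

def BiImmune (S : Set ℕ) : Prop := Immune S ∧ Immune Sᶜ

def BiHyperimmune (S : Set ℕ) : Prop := Hyperimmune S ∧ Hyperimmune Sᶜ

/-- `S` is the set of positions of the digit `1` in a binary expansion of `X`.
Only dyadic rationals have two expansions; then both sets are finite or cofinite. -/
def IsBinaryExpansion (X : ℝ) (S : Set ℕ) : Prop :=
  ∃ d : ℕ → Fin 2, Real.ofDigits d = X ∧ S = {n | d n = 1}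

/-- A real is finite if its binary expansion does not contain both infinitely many `1`s and
infinitely many `0`s. -/
def FiniteReal (X : ℝ) : Prop :=
  ∃ S, IsBinaryExpansion X S ∧ ¬ (S.Infinite ∧ Sᶜ.Infinite)

def ImmuneReal (X : ℝ) : Prop := ∃ S, IsBinaryExpansion X S ∧ Immune S

def HyperimmuneReal (X : ℝ) : Prop := ∃ S, IsBinaryExpansion X S ∧ Hyperimmune S

def BiImmuneReal (X : ℝ) : Prop := ∃ S, IsBinaryExpansion X S ∧ BiImmune S

def BiHyperimmuneReal (X : ℝ) : Prop := ∃ S, IsBinaryExpansion X S ∧ BiHyperimmune S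

/-- `Σ⁰₃` sets of natural numbers. -/
def IsSigma3 (A : Set ℕ) : Prop :=
  ∃ R : ℕ → ℕ → ℕ → ℕ → Prop,
    ComputablePred (fun p : ℕ × ℕ × ℕ × ℕ => R p.1 p.2.1 p.2.2.1 p.2.2.2) ∧
    ∀ x, x ∈ A ↔ ∃ a, ∀ b, ∃ c, R x a b c

/-- `Π⁰₃` sets: complements of `Σ⁰₃` sets. -/
def IsPi3 (A : Set ℕ) : Prop := IsSigma3 Aᶜ

def IsPi3Complete (A : Set ℕ) : Prop :=
  IsPi3 A ∧ ∀ X : Set ℕ, IsPi3 X → ManyOneReducible (fun n => n ∈ X) (fun n => n ∈ A)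

end LeftRE

/-!
A number which is the limit of a uniformly computable nondecreasing sequence `B s / 2 ^ s < 1` is
the weight of a program: at stage `s` one puts as many strings of length `s` into the domain as the
growth of the approximation demands (`hasWeight_growthNumbering`). So an acceptable numbering
receives every uniformly primitive recursive family of such approximations, and conversely the
numbers of a universal numbering have uniform approximations of this kind
(`isDyadicApprox_stageApprox`). The digits of such approximations converge to a binary expansion of
the limit (`IsDyadicApprox.exists_limitSet`), because every truncation to finitely many digits is
nondecreasing and bounded.

*Upper bound.* The expansions `S e` of a universal numbering are thus uniformly limit-computable.
Which expansion of a dyadic number is produced does not matter, since no finite or cofinite set has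
one of the properties in question (`exists_expansion_iff`). An infinite set `S` fails to be immune
if and only if there is a recursive `f` with `n ≤ f n ∈ S` for all `n`, and fails to be hyperimmune
if and only if there is a recursive `f` such that `S` has more than `n` elements below `f n`, for
all `n`. Both conditions on the values of `f` are decidable in the limit, hence can be replaced by
"at infinitely many stages the computation has halted and its value seems right", which gives the
form `∃ ∀ ∃` (`isSigma3_exists_computable`).

*Reduction.* Let `A` be `Σ⁰₃`, so that `x ∈ A` if and only if for some `a` a certain decidable event
occurs infinitely often (`IsSigma3.exists_event`). The digits of the number for `x` are organized in
consecutive zones, of decreasing priority; whenever a zone acts, all later zones are discarded. The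
zone `2 * a` acts whenever the event for `a` occurs, and then fills itself with ones beyond all
digits used so far. The zone `2 * e + 1`, starting at `p`, consists of a single `0` until `e` has
produced the values `v = f (p + 1)` and `w = f (p + 1 + v)` of its function `f`; then it becomes a
`1` followed by `v` zeros and `w` ones. Neither action decreases the number
(`truncValue_nextZones_le`). If `x ∈ A`, the zones before that of the least `a` with infinitely many
events stabilize, and that zone grows into an infinite block of ones, so that the number is dyadic.
If `x ∉ A`, all zones stabilize; below `p + 1 + v` there are then at most `p + 1` ones, so that `f`
does not bound the positions of the ones, and likewise the last `w` ones prevent `f` from bounding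
the positions of the zeros (`biHyperimmune_of_blocks`).
-/

open Filter Topology

namespace LeftRE

/-! ### Binary expansions -/

theorem ofDigits_two_eq_shift (d : ℕ → Fin 2) :
    Real.ofDigits d = ((d 0 : ℕ) + Real.ofDigits fun i => d (i + 1)) / 2 := by
  rw [Real.ofDigits_eq_sum_add_ofDigits d 1]
  simp [Real.ofDigitsTerm]
  ring

theorem eq_zero_of_ofDigits_eq_zero (d : ℕ → Fin 2) (h : Real.ofDigits d = 0) (i : ℕ) :
    d i = 0 := by
  induction i generalizing d with
  | zero =>
    rw [ofDigits_two_eq_shift] at h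
    have h1 := Real.ofDigits_nonneg fun i => d (i + 1)
    have h2 : ((d 0 : ℕ) : ℝ) ≤ 0 := by linarith
    have h3 : (d 0 : ℕ) ≤ 0 := by exact_mod_cast h2
    exact Fin.ext (by simpa using h3)
  | succ i ih =>
    refine ih (fun i => d (i + 1)) ?_
    rw [ofDigits_two_eq_shift] at h
    have h1 := Real.ofDigits_nonneg fun i => d (i + 1)
    have h2 : (0 : ℝ) ≤ (d 0 : ℕ) := by positivity
    linarith

theorem eq_one_of_ofDigits_eq_one (d : ℕ → Fin 2) (h : Real.ofDigits d = 1) (i : ℕ) :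
    d i = 1 := by
  have h4 : ∀ d : ℕ → Fin 2, (d 0 : ℕ) ≤ 1 := fun d => by have := (d 0).isLt; omega
  induction i generalizing d with
  | zero =>
    rw [ofDigits_two_eq_shift] at h
    have h1 := Real.ofDigits_le_one fun i => d (i + 1)
    have h2 : (1 : ℝ) ≤ ((d 0 : ℕ) : ℝ) := by linarith
    have h3 : 1 ≤ (d 0 : ℕ) := by exact_mod_cast h2
    exact Fin.ext (le_antisymm (h4 d) h3)
  | succ i ih =>
    refine ih (fun i => d (i + 1)) ?_
    rw [ofDigits_two_eq_shift] at h
    have h1 := Real.ofDigits_le_one fun i => d (i + 1)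
    have h2 : ((d 0 : ℕ) : ℝ) ≤ 1 := by exact_mod_cast h4 d
    linarith

theorem eventually_const_of_ofDigits_eq_of_head_ne {d d' : ℕ → Fin 2}
    (h : Real.ofDigits d = Real.ofDigits d') (h0 : d 0 ≠ d' 0) :
    (∀ i ≥ 1, d i = 0) ∨ ∀ i ≥ 1, d i = 1 := by
  have hs : ∀ (c : Fin 2), (∀ i, d (i + 1) = c) → ∀ i ≥ 1, d i = c := fun c hc i hi => by
    obtain ⟨j, rfl⟩ := Nat.exists_eq_add_of_le' hi
    exact hc j
  rw [ofDigits_two_eq_shift, ofDigits_two_eq_shift d'] at h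
  have a1 := Real.ofDigits_le_one fun i => d (i + 1)
  have a2 := Real.ofDigits_nonneg fun i => d (i + 1)
  have b1 := Real.ofDigits_le_one fun i => d' (i + 1)
  have b2 := Real.ofDigits_nonneg fun i => d' (i + 1)
  have key : (d 0 = 0 ∧ d' 0 = 1) ∨ (d 0 = 1 ∧ d' 0 = 0) := by
    revert h0; generalize d 0 = u; generalize d' 0 = v; revert u v; decide
  rcases key with ⟨h0, h1⟩ | ⟨h0, h1⟩
  · right
    refine hs 1 (eq_one_of_ofDigits_eq_one (fun i => d (i + 1)) ?_)
    simp [h0, h1] at h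
    linarith
  · left
    refine hs 0 (eq_zero_of_ofDigits_eq_zero (fun i => d (i + 1)) ?_)
    simp [h0, h1] at h
    linarith

/-- Two digit sequences of one number differ only if the number is dyadic, so that they are
eventually constant. -/
theorem eventually_const_of_ofDigits_eq {d d' : ℕ → Fin 2}
    (h : Real.ofDigits d = Real.ofDigits d') {n : ℕ} (hn : d n ≠ d' n) :
    ∃ N, (∀ i ≥ N, d i = 0) ∨ ∀ i ≥ N, d i = 1 := by
  induction n generalizing d d' with
  | zero => exact ⟨1, eventually_const_of_ofDigits_eq_of_head_ne h hn⟩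
  | succ n ih =>
    by_cases h0 : d 0 = d' 0
    · have h' : (Real.ofDigits fun i => d (i + 1)) = Real.ofDigits fun i => d' (i + 1) := by
        rw [ofDigits_two_eq_shift, ofDigits_two_eq_shift d', h0] at h
        linarith
      obtain ⟨N, hN⟩ := ih h' hn
      have hs : ∀ (c : Fin 2), (∀ i ≥ N, d (i + 1) = c) → ∀ i ≥ N + 1, d i = c := by
        intro c hc i hi
        obtain ⟨j, rfl⟩ := Nat.exists_eq_add_of_le' (show 1 ≤ i by omega)
        exact hc j (by omega)
      exact ⟨N + 1, hN.imp (hs 0) (hs 1)⟩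
    · exact ⟨1, eventually_const_of_ofDigits_eq_of_head_ne h h0⟩

/-- A binary expansion which is not the only one is finite or cofinite. -/
theorem not_infinite_of_ne {X : ℝ} {S S' : Set ℕ} (h : IsBinaryExpansion X S)
    (h' : IsBinaryExpansion X S') (hne : S ≠ S') : ¬ (S.Infinite ∧ Sᶜ.Infinite) := by
  obtain ⟨d, hd, rfl⟩ := h
  obtain ⟨d', hd', rfl⟩ := h'
  obtain ⟨n, hn⟩ : ∃ n, d n ≠ d' n := by
    by_contra hcon
    push Not at hcon
    exact hne (by rw [funext hcon])
  rintro ⟨h1, h0⟩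
  obtain ⟨N, hN | hN⟩ := eventually_const_of_ofDigits_eq (hd.trans hd'.symm) hn
  · obtain ⟨i, hi, hi'⟩ := h1.exists_gt N
    have := hN i hi'.le
    simp_all
  · obtain ⟨i, hi, hi'⟩ := h0.exists_gt N
    exact hi (hN i hi'.le)

/-- A property which no finite or cofinite set has is independent of the choice of the binary
expansion. -/
theorem exists_expansion_iff {P : Set ℕ → Prop} (hP : ∀ S, P S → S.Infinite ∧ Sᶜ.Infinite)
    {X : ℝ} {S : Set ℕ} (h : IsBinaryExpansion X S) :
    (∃ S', IsBinaryExpansion X S' ∧ P S') ↔ P S := by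
  refine ⟨?_, fun hS => ⟨S, h, hS⟩⟩
  rintro ⟨S', h', hS'⟩
  by_contra hS
  exact not_infinite_of_ne h' h (fun e => hS (e ▸ hS')) (hP S' hS')

theorem not_exists_expansion_of_finiteReal {P : Set ℕ → Prop}
    (hP : ∀ S, P S → S.Infinite ∧ Sᶜ.Infinite) {X : ℝ} (h : FiniteReal X) :
    ¬ ∃ S', IsBinaryExpansion X S' ∧ P S' := by
  obtain ⟨S, hS, hfin⟩ := h
  rw [exists_expansion_iff hP hS]
  exact fun h => hfin (hP S h)

/-! ### Dyadic approximations from below -/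

/-- `B s / 2 ^ s` is a nondecreasing sequence in `[0, 1)` converging to `X`. -/
structure IsDyadicApprox (B : ℕ → ℕ) (X : ℝ) : Prop where
  lt_pow : ∀ s, B s < 2 ^ s
  mono : ∀ s, 2 * B s ≤ B (s + 1)
  tendsto : Tendsto (fun s => (B s : ℝ) / 2 ^ s) atTop (𝓝 X)

/-- The `n`-th binary digit of `B s / 2 ^ s`. -/
def dyadicDigit (B : ℕ → ℕ) (s n : ℕ) : Bool :=
  decide (B s * 2 ^ (n + 1) / 2 ^ s % 2 = 1)

/-- The sets coded by the rows of `D` converge pointwise to `S`. -/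
def IsLimitSet (D : ℕ → ℕ → Bool) (S : Set ℕ) : Prop :=
  ∀ n, ∀ᶠ s in atTop, (D s n = true ↔ n ∈ S)

theorem IsLimitSet.congr {D D' : ℕ → ℕ → Bool} {S : Set ℕ} (h : IsLimitSet D S)
    (hD : ∀ n, ∀ᶠ s in atTop, D s n = D' s n) : IsLimitSet D' S := fun n => by
  filter_upwards [h n, hD n] with s hs hs'
  rw [← hs', hs]

theorem IsLimitSet.compl {D : ℕ → ℕ → Bool} {S : Set ℕ} (h : IsLimitSet D S) :
    IsLimitSet (fun s n => !D s n) Sᶜ := fun n => by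
  filter_upwards [h n] with s hs
  rw [Set.mem_compl_iff, ← hs]
  simp

theorem eventually_const_of_monotone_of_le {q : ℕ → ℕ} (hq : Monotone q) {M : ℕ}
    (hM : ∀ s, q s ≤ M) : ∃ c, ∀ᶠ s in atTop, q s = c := by
  have hb : BddAbove (Set.range q) := ⟨M, by rintro _ ⟨s, rfl⟩; exact hM s⟩
  obtain ⟨s₀, hs₀⟩ := Nat.sSup_mem (Set.range_nonempty q) hb
  refine ⟨q s₀, eventually_atTop.2 ⟨s₀, fun s hs => le_antisymm ?_ (hq hs)⟩⟩
  rw [hs₀]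
  exact le_csSup hb ⟨s, rfl⟩

/-- The digits of the approximations converge to a binary expansion of the limit: every
truncation to finitely many digits is nondecreasing and takes only finitely many values. -/
theorem IsDyadicApprox.exists_limitSet {B : ℕ → ℕ} {X : ℝ} (h : IsDyadicApprox B X) :
    ∃ S, IsBinaryExpansion X S ∧ IsLimitSet (dyadicDigit B) S := by
  have hc : ∀ n, ∃ c, ∀ᶠ s in atTop, B s * 2 ^ (n + 1) / 2 ^ s = c := by
    intro n
    refine eventually_const_of_monotone_of_le (M := 2 ^ (n + 1)) (monotone_nat_of_le_succ ?_) ?_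
    · intro s
      calc B s * 2 ^ (n + 1) / 2 ^ s = (2 * (B s * 2 ^ (n + 1))) / (2 * 2 ^ s) :=
            (Nat.mul_div_mul_left _ _ two_pos).symm
        _ = (2 * B s) * 2 ^ (n + 1) / 2 ^ (s + 1) := by rw [pow_succ' 2 s, mul_assoc]
        _ ≤ _ := Nat.div_le_div_right (Nat.mul_le_mul_right _ (h.mono s))
    · intro s
      refine Nat.div_le_of_le_mul ?_
      gcongr
      exact (h.lt_pow s).le
  choose c hc using hc
  let d : ℕ → Fin 2 := fun n => Fin.ofNat 2 (c n)
  refine ⟨{n | d n = 1}, ⟨d, ?_, rfl⟩, fun n => ?_⟩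
  · have hmem : ∀ s, (B s : ℝ) / 2 ^ s ∈ Set.Ico (0 : ℝ) 1 := fun s =>
      ⟨by positivity, by rw [div_lt_one (by positivity)]; exact_mod_cast h.lt_pow s⟩
    have h1 : Tendsto (fun s => Real.digits ((B s : ℝ) / 2 ^ s) 2) atTop (𝓝 d) := by
      rw [tendsto_pi_nhds]
      intro n
      refine tendsto_const_nhds.congr' ?_
      filter_upwards [hc n] with s hs
      have : (B s : ℝ) / 2 ^ s * ((2 : ℕ) : ℝ) ^ (n + 1)
          = ((B s * 2 ^ (n + 1) : ℕ) : ℝ) / ((2 ^ s : ℕ) : ℝ) := by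
        push_cast
        ring
      simp only [Real.digits, d]
      rw [this, Nat.floor_div_eq_div, hs]
    have h2 := (Real.continuous_ofDigits.tendsto d).comp h1
    refine tendsto_nhds_unique h2 (h.tendsto.congr fun s => ?_)
    exact (Real.ofDigits_digits one_lt_two (hmem s)).symm
  · filter_upwards [hc n] with s hs
    simp only [dyadicDigit, hs, decide_eq_true_eq, d, Fin.ext_iff]
    simp

/-! ### Primitive recursive bookkeeping -/

theorem primrec_sum_range {σ : Type*} [Primcodable σ] {f : σ → ℕ} {g : σ → ℕ → ℕ}
    (hf : Primrec f) (hg : Primrec₂ g) :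
    Primrec fun a => ∑ i ∈ Finset.range (f a), g a i := by
  refine (Primrec.nat_rec' (h := fun a (p : ℕ × ℕ) => p.2 + g a p.1) hf (Primrec.const 0)
    ?_).of_eq fun a => ?_
  · exact Primrec.nat_add.comp (Primrec.snd.comp Primrec.snd)
      (hg.comp Primrec.fst (Primrec.fst.comp Primrec.snd))
  · induction f a with
    | zero => rfl
    | succ n ih => rw [Finset.sum_range_succ, ← ih]

theorem primrec_two_pow : Primrec fun n : ℕ => 2 ^ n := by
  refine (Primrec.nat_rec₁ (f := fun _ r => 2 * r) 1 ?_).of_eq fun n => ?_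
  · exact (Primrec.nat_mul.comp (Primrec.const 2) Primrec.snd)
  · induction n with
    | zero => rfl
    | succ n ih => rw [pow_succ', ← ih]

theorem primrec_evaln_comp {σ : Type*} [Primcodable σ] {s n : σ → ℕ} {c : σ → Nat.Partrec.Code}
    (hs : Primrec s) (hc : Primrec c) (hn : Primrec n) :
    Primrec fun a => Nat.Partrec.Code.evaln (s a) (c a) (n a) :=
  Nat.Partrec.Code.primrec_evaln.comp ((hs.pair hc).pair hn)

theorem primrec_isSome {σ τ : Type*} [Primcodable σ] [Primcodable τ] {f : σ → Option τ}
    (hf : Primrec f) : PrimrecPred fun a => (f a).isSome = true :=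
  Primrec.eq.comp (Primrec.option_isSome.comp hf) (Primrec.const true)

/-! ### Approximating a given numbering -/

/-- The contribution, in units of `2 ^ (-s)`, of the string with number `i` to the weight of the
`e`-th program of the numbering with code `c` at stage `s`: the string counts if it has length at
most `s` and the computation halts within `s` steps. -/
def stageTerm (c : Nat.Partrec.Code) (e s i : ℕ) : ℕ :=
  ((Encodable.decode i : Option (List Bool)).map fun σ =>
    if Encodable.encode σ = i ∧ σ.length ≤ s ∧
      (Nat.Partrec.Code.evaln s c (Encodable.encode (e, σ))).isSome = true
    then 2 ^ (s - σ.length) else 0).getD 0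

/-- The weight of the `e`-th program found up to stage `s`, in units of `2 ^ (-s)`. Taking the
minimum keeps the approximation below `1` even if the weight `1` is attained at a finite stage. -/
def stageApprox (c : Nat.Partrec.Code) (e s : ℕ) : ℕ :=
  min (∑ i ∈ Finset.range s, stageTerm c e s i) (2 ^ s - 1)

theorem primrec_stageApprox (c : Nat.Partrec.Code) : Primrec₂ (stageApprox c) := by
  have hs : Primrec fun p : ((ℕ × ℕ) × ℕ) × List Bool => p.1.1.2 :=
    Primrec.snd.comp (Primrec.fst.comp Primrec.fst)
  have hlen : Primrec fun p : ((ℕ × ℕ) × ℕ) × List Bool => p.2.length :=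
    Primrec.list_length.comp Primrec.snd
  have h1 : Primrec₂ fun (p : ℕ × ℕ) (i : ℕ) => stageTerm c p.1 p.2 i := by
    refine Primrec.option_getD.comp (Primrec.option_map
      (Primrec.decode.comp Primrec.snd) ?_) (Primrec.const 0)
    refine Primrec.ite ?_ ?_ (Primrec.const 0)
    · refine PrimrecPred.and ?_ (PrimrecPred.and ?_ ?_)
      · exact Primrec.eq.comp (Primrec.encode.comp Primrec.snd) (Primrec.snd.comp Primrec.fst)
      · exact Primrec.nat_le.comp hlen hs
      · refine primrec_isSome (primrec_evaln_comp hs (Primrec.const c) (Primrec.encode.comp ?_))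
        exact (Primrec.fst.comp (Primrec.fst.comp Primrec.fst)).pair Primrec.snd
    · exact primrec_two_pow.comp (Primrec.nat_sub.comp hs hlen)
  refine Primrec.nat_min.comp (primrec_sum_range Primrec.snd h1) ?_
  exact Primrec.nat_sub.comp (primrec_two_pow.comp Primrec.snd) (Primrec.const 1)

/-- The code `c` has the domain of the numbering `φ`. -/
def HasDomOf (c : Nat.Partrec.Code) (φ : ℕ → List Bool →. ℕ) : Prop :=
  ∀ e σ, (φ e σ).Dom ↔
    ∃ s, (Nat.Partrec.Code.evaln s c (Encodable.encode (e, σ))).isSome = true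

theorem exists_code_of_isNumbering {φ : ℕ → List Bool →. ℕ} (h : IsNumbering φ) :
    ∃ c, HasDomOf c φ := by
  obtain ⟨c, hc⟩ := Nat.Partrec.Code.exists_code.1 h
  refine ⟨c, fun e σ => ?_⟩
  have h1 : (φ e σ).Dom ↔ (c.eval (Encodable.encode (e, σ))).Dom := by
    rw [hc]
    simp
  rw [h1, Part.dom_iff_mem]
  simp only [Nat.Partrec.Code.evaln_complete, Option.isSome_iff_exists, Option.mem_def]
  exact exists_comm

/-- The weight of the string with number `i`, or `0` if there is no such string in the domain of
`ψ`. -/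
noncomputable def codeWeight (ψ : List Bool →. ℕ) (i : ℕ) : ℝ :=
  Function.extend (fun σ : {σ : List Bool // (ψ σ).Dom} => Encodable.encode σ.1)
    (fun σ => (2⁻¹ : ℝ) ^ σ.1.length) 0 i

theorem encode_subtype_injective (ψ : List Bool →. ℕ) : Function.Injective
    fun σ : {σ : List Bool // (ψ σ).Dom} => Encodable.encode σ.1 :=
  Encodable.encode_injective.comp Subtype.val_injective

theorem hasSum_codeWeight {ψ : List Bool →. ℕ} {X : ℝ} (h : HasWeight ψ X) :
    HasSum (codeWeight ψ) X :=
  (hasSum_extend_zero (encode_subtype_injective ψ)).2 h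

theorem codeWeight_encode {ψ : List Bool →. ℕ} {σ : List Bool} (h : (ψ σ).Dom) :
    codeWeight ψ (Encodable.encode σ) = 2⁻¹ ^ σ.length :=
  (encode_subtype_injective ψ).extend_apply _ _ ⟨σ, h⟩

theorem codeWeight_eq_zero {ψ : List Bool →. ℕ} {i : ℕ}
    (h : ∀ σ, Encodable.encode σ = i → ¬ (ψ σ).Dom) : codeWeight ψ i = 0 :=
  Function.extend_apply' _ _ _ fun ⟨σ, hσ⟩ => h σ.1 hσ σ.2

theorem codeWeight_nonneg (ψ : List Bool →. ℕ) (i : ℕ) : 0 ≤ codeWeight ψ i := by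
  by_cases h : ∃ σ, Encodable.encode σ = i ∧ (ψ σ).Dom
  · obtain ⟨σ, rfl, h⟩ := h
    rw [codeWeight_encode h]
    positivity
  · push Not at h
    exact (codeWeight_eq_zero h).ge

theorem stageTerm_encode (c : Nat.Partrec.Code) (e s : ℕ) (σ : List Bool) :
    stageTerm c e s (Encodable.encode σ) = if σ.length ≤ s ∧
      (Nat.Partrec.Code.evaln s c (Encodable.encode (e, σ))).isSome = true
      then 2 ^ (s - σ.length) else 0 := by
  simp only [stageTerm, Encodable.encodek, Option.map_some, Option.getD_some, true_and]

theorem stageTerm_eq_zero (c : Nat.Partrec.Code) (e s : ℕ) {i : ℕ}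
    (h : ∀ σ : List Bool, Encodable.encode σ ≠ i) : stageTerm c e s i = 0 := by
  rw [stageTerm]
  rcases (Encodable.decode i : Option (List Bool)) with _ | σ
  · rfl
  · simp [h σ]

theorem isSome_evaln_mono {c : Nat.Partrec.Code} {s t n : ℕ} (hst : s ≤ t)
    (h : (Nat.Partrec.Code.evaln s c n).isSome = true) :
    (Nat.Partrec.Code.evaln t c n).isSome = true := by
  obtain ⟨y, hy⟩ := Option.isSome_iff_exists.1 h
  exact Option.isSome_iff_exists.2 ⟨y, Nat.Partrec.Code.evaln_mono hst hy⟩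

theorem two_mul_stageTerm_le (c : Nat.Partrec.Code) (e s i : ℕ) :
    2 * stageTerm c e s i ≤ stageTerm c e (s + 1) i := by
  by_cases h : ∃ σ : List Bool, Encodable.encode σ = i
  · obtain ⟨σ, rfl⟩ := h
    rw [stageTerm_encode, stageTerm_encode]
    split_ifs with h1 h2
    · rw [← pow_succ', Nat.sub_add_comm h1.1]
    · exact absurd ⟨h1.1.trans (Nat.le_succ s), isSome_evaln_mono (Nat.le_succ s) h1.2⟩ h2
    · simp
    · simp
  · push Not at h
    simp [stageTerm_eq_zero c e _ h]

theorem stageTerm_div_le {φ : ℕ → List Bool →. ℕ}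
    {c : Nat.Partrec.Code} (hc : HasDomOf c φ) (e s i : ℕ) :
    (stageTerm c e s i : ℝ) / 2 ^ s ≤ codeWeight (φ e) i := by
  by_cases h : ∃ σ : List Bool, Encodable.encode σ = i
  · obtain ⟨σ, rfl⟩ := h
    rw [stageTerm_encode]
    split_ifs with h1
    · rw [codeWeight_encode ((hc e σ).2 ⟨s, h1.2⟩)]
      push_cast
      rw [pow_sub₀ _ two_ne_zero h1.1, inv_pow]
      field_simp
      rfl
    · simpa using codeWeight_nonneg _ _
  · push Not at h
    simpa [stageTerm_eq_zero c e s h] using codeWeight_nonneg _ _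

theorem eventually_stageTerm_div_eq {φ : ℕ → List Bool →. ℕ}
    {c : Nat.Partrec.Code} (hc : HasDomOf c φ) (e i : ℕ) :
    ∀ᶠ s in atTop, (stageTerm c e s i : ℝ) / 2 ^ s = codeWeight (φ e) i := by
  by_cases h : ∃ σ : List Bool, Encodable.encode σ = i
  · obtain ⟨σ, rfl⟩ := h
    by_cases hd : (φ e σ).Dom
    · obtain ⟨s₀, hs₀⟩ := (hc e σ).1 hd
      filter_upwards [eventually_ge_atTop s₀, eventually_ge_atTop σ.length] with s h1 h2
      rw [codeWeight_encode hd, stageTerm_encode, if_pos ⟨h2, isSome_evaln_mono h1 hs₀⟩]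
      push_cast
      rw [pow_sub₀ _ two_ne_zero h2, inv_pow]
      field_simp
    · refine Eventually.of_forall fun s => ?_
      rw [codeWeight_eq_zero fun τ hτ => by rwa [Encodable.encode_injective hτ], stageTerm_encode,
        if_neg fun h1 => hd ((hc e σ).2 ⟨s, h1.2⟩)]
      simp
  · push Not at h
    refine Eventually.of_forall fun s => ?_
    rw [stageTerm_eq_zero c e s h, codeWeight_eq_zero fun σ hσ => absurd hσ (h σ)]
    simp

theorem tendsto_sum_stageTerm {φ : ℕ → List Bool →. ℕ}
    {c : Nat.Partrec.Code} (hc : HasDomOf c φ) {e : ℕ} {X : ℝ} (h : HasWeight (φ e) X) :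
    Tendsto (fun s => ((∑ i ∈ Finset.range s, stageTerm c e s i : ℕ) : ℝ) / 2 ^ s)
      atTop (𝓝 X) := by
  have hsum := hasSum_codeWeight h
  have h1 := tendsto_tsum_of_dominated_convergence (𝓕 := atTop) (bound := codeWeight (φ e))
    (f := fun s i => if i < s then (stageTerm c e s i : ℝ) / 2 ^ s else 0)
    (g := codeWeight (φ e)) hsum.summable ?_ ?_
  · rw [hsum.tsum_eq] at h1
    refine h1.congr fun s => ?_
    rw [tsum_eq_sum (s := Finset.range s) (by simp +contextual)]
    push_cast
    rw [Finset.sum_div]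
    exact Finset.sum_congr rfl fun i hi => if_pos (Finset.mem_range.1 hi)
  · intro i
    refine tendsto_const_nhds.congr' ?_
    filter_upwards [eventually_stageTerm_div_eq hc e i, eventually_gt_atTop i] with s hs his
    rw [if_pos his, hs]
  · refine Eventually.of_forall fun s i => ?_
    split_ifs
    · rw [Real.norm_of_nonneg (by positivity)]
      exact stageTerm_div_le hc e s i
    · simpa using codeWeight_nonneg _ _

theorem isDyadicApprox_stageApprox {φ : ℕ → List Bool →. ℕ}
    {c : Nat.Partrec.Code} (hc : HasDomOf c φ) {e : ℕ} {X : ℝ} (h : HasWeight (φ e) X)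
    (hX : X ≤ 1) :
    IsDyadicApprox (stageApprox c e) X := by
  have hle : ∀ s, ∑ i ∈ Finset.range s, stageTerm c e s i ≤ 2 ^ s := fun s => by
    have h1 : ∑ i ∈ Finset.range s, (stageTerm c e s i : ℝ) / 2 ^ s ≤ 1 :=
      ((Finset.sum_le_sum fun i _ => stageTerm_div_le hc e s i).trans
        (sum_le_hasSum _ (fun i _ => codeWeight_nonneg _ i) (hasSum_codeWeight h))).trans hX
    rw [← Finset.sum_div, div_le_one (by positivity)] at h1
    exact_mod_cast h1
  refine ⟨fun s => ?_, fun s => ?_, ?_⟩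
  · have : 0 < 2 ^ s := by positivity
    unfold stageApprox
    omega
  · have h1 : 2 * ∑ i ∈ Finset.range s, stageTerm c e s i
        ≤ ∑ i ∈ Finset.range (s + 1), stageTerm c e (s + 1) i := by
      rw [Finset.mul_sum, Finset.sum_range_succ]
      exact (Finset.sum_le_sum fun i _ => two_mul_stageTerm_le c e s i).trans (Nat.le_add_right _ _)
    have : 2 ^ (s + 1) = 2 * 2 ^ s := pow_succ' 2 s
    unfold stageApprox
    omega
  · have h1 := tendsto_sum_stageTerm hc h
    have h2 : Tendsto (fun s : ℕ => ((1 : ℝ) / 2) ^ s) atTop (𝓝 0) :=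
      tendsto_pow_atTop_nhds_zero_of_lt_one (by norm_num) (by norm_num)
    refine tendsto_of_tendsto_of_tendsto_of_le_of_le (by simpa using h1.sub h2) h1
      (fun s => ?_) (fun s => ?_)
    · have h3 : ∑ i ∈ Finset.range s, stageTerm c e s i ≤ stageApprox c e s + 1 := by
        have := hle s
        unfold stageApprox
        omega
      have h4 : ((∑ i ∈ Finset.range s, stageTerm c e s i : ℕ) : ℝ) ≤ stageApprox c e s + 1 := by
        exact_mod_cast h3
      rw [← Nat.cast_sum, ← one_div, ← sub_div]
      gcongr
      exact sub_le_iff_le_add.2 h4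
    · simp only
      gcongr
      exact min_le_left _ _

/-! ### From approximations to numberings -/

/-- The number with the binary digits `σ`, least significant digit first. -/
def binaryValue (σ : List Bool) : ℕ := σ.foldr (fun b n => b.toNat + 2 * n) 0

theorem binaryValue_injective {σ τ : List Bool} (hl : σ.length = τ.length)
    (h : binaryValue σ = binaryValue τ) : σ = τ := by
  induction σ generalizing τ with
  | nil => exact (List.length_eq_zero_iff.1 hl.symm).symm
  | cons b σ ih =>
    rcases τ with _ | ⟨b', τ⟩
    · simp at hl
    simp only [binaryValue, List.foldr_cons] at h
    have hb := Bool.toNat_lt b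
    have hb' := Bool.toNat_lt b'
    have h1 : b = b' := by cases b <;> cases b' <;> simp at h ⊢ <;> omega
    subst h1
    rw [ih (by simpa using hl) (by unfold binaryValue; omega)]

theorem exists_binaryValue_eq (n : ℕ) : ∀ j < 2 ^ n, ∃ σ : List Bool,
    σ.length = n ∧ binaryValue σ = j := by
  induction n with
  | zero => exact fun j hj => ⟨[], rfl, by simp at hj; simp [binaryValue, hj]⟩
  | succ n ih =>
    intro j hj
    rw [pow_succ'] at hj
    obtain ⟨σ, hσ, hv⟩ := ih (j / 2) (by omega)
    refine ⟨decide (j % 2 = 1) :: σ, by simp [hσ], ?_⟩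
    simp only [binaryValue, List.foldr_cons] at hv ⊢
    rw [hv]
    rcases Nat.mod_two_eq_zero_or_one j with h | h <;> simp [h] <;> omega

/-- The numbering whose `x`-th domain contains, for every `n`, as many strings of length `n` as
the growth of `B x n / 2 ^ n` at stage `n` demands. -/
def growthNumbering (B : ℕ → ℕ → ℕ) (x : ℕ) (σ : List Bool) : Part ℕ :=
  ((if binaryValue σ < B x σ.length - 2 * B x (σ.length - 1) then some 0 else none : Option ℕ) :
    Part ℕ)

theorem growthNumbering_dom (B : ℕ → ℕ → ℕ) (x : ℕ) (σ : List Bool) :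
    (growthNumbering B x σ).Dom ↔ binaryValue σ < B x σ.length - 2 * B x (σ.length - 1) := by
  unfold growthNumbering
  split_ifs with h <;> simp [h]

theorem isNumbering_growthNumbering {B : ℕ → ℕ → ℕ} (hB : Primrec₂ B) :
    IsNumbering (growthNumbering B) := by
  have hl : Primrec fun p : ℕ × List Bool => p.2.length := Primrec.list_length.comp Primrec.snd
  have hb : Primrec binaryValue := by
    refine Primrec.list_foldr Primrec.id (Primrec.const 0)
      (h := fun _ (p : Bool × ℕ) => p.1.toNat + 2 * p.2) ?_
    refine Primrec.nat_add.comp ?_ (Primrec.nat_mul.comp (Primrec.const 2)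
      (Primrec.snd.comp Primrec.snd))
    exact (Primrec.dom_finite Bool.toNat).comp (Primrec.fst.comp Primrec.snd)
  refine Computable.ofOption (Primrec.to_comp ?_)
  refine Primrec.ite (Primrec.nat_lt.comp (hb.comp Primrec.snd) ?_) (Primrec.const (some 0))
    (Primrec.const none)
  exact Primrec.nat_sub.comp (hB.comp Primrec.fst hl) (Primrec.nat_mul.comp (Primrec.const 2)
    (hB.comp Primrec.fst (Primrec.nat_sub.comp hl (Primrec.const 1))))

theorem hasWeight_growthNumbering {B : ℕ → ℕ → ℕ} {x : ℕ} {X : ℝ}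
    (h : IsDyadicApprox (B x) X) : HasWeight (growthNumbering B x) X := by
  let C : ℕ → ℕ := fun n => B x n - 2 * B x (n - 1)
  let F : {σ : List Bool // (growthNumbering B x σ).Dom} → Σ n, Fin (C n) :=
    fun σ => ⟨σ.1.length, ⟨binaryValue σ.1, (growthNumbering_dom B x σ.1).1 σ.2⟩⟩
  have hF : Function.Bijective F := by
    constructor
    · rintro ⟨σ, hσ⟩ ⟨τ, hτ⟩ hst
      have h1 : σ.length = τ.length := congrArg Sigma.fst hst
      have h2 : binaryValue σ = binaryValue τ :=
        congrArg (fun p : Σ n, Fin (C n) => (p.2 : ℕ)) hst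
      exact Subtype.ext (binaryValue_injective h1 h2)
    · rintro ⟨n, j, hj⟩
      have hlt : j < 2 ^ n := by
        have := h.lt_pow n
        simp only [C] at hj
        omega
      obtain ⟨σ, rfl, rfl⟩ := exists_binaryValue_eq n j hlt
      exact ⟨⟨σ, (growthNumbering_dom B x σ).2 hj⟩, rfl⟩
  have hpart : ∀ n, ∑ i ∈ Finset.range (n + 1), (C i : ℝ) * (2⁻¹ : ℝ) ^ i
      = (B x n : ℝ) / 2 ^ n := by
    intro n
    induction n with
    | zero =>
      have := h.lt_pow 0
      have h0 : B x 0 = 0 := by simpa using this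
      simp [C, h0]
    | succ n ih =>
      rw [Finset.sum_range_succ, ih]
      simp only [C, Nat.add_sub_cancel]
      rw [Nat.cast_sub (h.mono n)]
      push_cast
      rw [pow_succ, pow_succ, inv_pow]
      field_simp
      ring
  have hC : HasSum (fun n => (C n : ℝ) * (2⁻¹ : ℝ) ^ n) X := by
    rw [hasSum_iff_tendsto_nat_of_nonneg fun n => by positivity]
    rw [← tendsto_add_atTop_iff_nat 1]
    exact h.tendsto.congr fun n => (hpart n).symm
  have hfib : ∀ n, HasSum (fun _ : Fin (C n) => (2⁻¹ : ℝ) ^ n) ((C n : ℝ) * (2⁻¹ : ℝ) ^ n) :=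
    fun n => by simpa using hasSum_fintype fun _ : Fin (C n) => (2⁻¹ : ℝ) ^ n
  have hsig : HasSum (fun p : Σ n, Fin (C n) => (2⁻¹ : ℝ) ^ p.1) X := by
    refine HasSum.sigma_of_hasSum hC hfib ?_
    refine (summable_sigma_of_nonneg fun p => by positivity).2
      ⟨fun n => (hfib n).summable, ?_⟩
    exact hC.summable.congr fun n => (hfib n).tsum_eq.symm
  exact ((Equiv.ofBijective F hF).hasSum_iff
    (f := fun p : Σ n, Fin (C n) => (2⁻¹ : ℝ) ^ p.1)).2 hsig

theorem IsDyadicApprox.mem_Icc {B : ℕ → ℕ} {X : ℝ} (h : IsDyadicApprox B X) :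
    X ∈ Set.Icc (0 : ℝ) 1 := by
  refine isClosed_Icc.mem_of_tendsto h.tendsto (Eventually.of_forall fun s => ⟨by positivity, ?_⟩)
  rw [div_le_one (by positivity)]
  exact_mod_cast (h.lt_pow s).le

/-- An acceptable numbering receives every uniformly primitive recursive sequence of
approximations. -/
theorem IsAcceptable.exists_computable {α : ℕ → ℝ} (ha : IsAcceptable α) {B : ℕ → ℕ → ℕ}
    (hB : Primrec₂ B) {β : ℕ → ℝ} (h : ∀ x, IsDyadicApprox (B x) (β x)) :
    ∃ f : ℕ → ℕ, Computable f ∧ ∀ x, α (f x) = β x := by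
  refine ha (Set.range β) β ⟨?_, rfl, growthNumbering B, isNumbering_growthNumbering hB,
    fun x => hasWeight_growthNumbering (h x)⟩
  rintro _ ⟨x, rfl⟩
  exact ⟨(h x).mem_Icc, growthNumbering B, isNumbering_growthNumbering hB, x,
    hasWeight_growthNumbering (h x)⟩

/-! ### The level `Σ⁰₃` -/

theorem isSigma3_of_frequently {A : Set ℕ} {G : ℕ → ℕ → ℕ → ℕ → Prop}
    (hG : PrimrecPred fun p : ℕ × ℕ × ℕ × ℕ => G p.1 p.2.1 p.2.2.1 p.2.2.2)
    (h : ∀ x, x ∈ A ↔ ∃ a, ∀ n, ∃ᶠ t in atTop, G x a n t) : IsSigma3 A := by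
  refine ⟨fun x a b t => b.unpair.2 ≤ t ∧ G x a b.unpair.1 t, ?_, fun x => ?_⟩
  · have hb : Primrec fun p : ℕ × ℕ × ℕ × ℕ => p.2.2.1.unpair :=
      Primrec.unpair.comp (Primrec.fst.comp (Primrec.snd.comp Primrec.snd))
    have ht : Primrec fun p : ℕ × ℕ × ℕ × ℕ => p.2.2.2 :=
      Primrec.snd.comp (Primrec.snd.comp Primrec.snd)
    refine PrimrecPred.computablePred ((Primrec.nat_le.comp (Primrec.snd.comp hb) ht).and ?_)
    exact hG.comp (Primrec.fst.pair ((Primrec.fst.comp Primrec.snd).pair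
      ((Primrec.fst.comp hb).pair ht)))
  · rw [h]
    refine exists_congr fun a => ?_
    simp only [frequently_atTop]
    refine ⟨fun H b => H b.unpair.1 b.unpair.2, fun H n s => ?_⟩
    simpa using H (Nat.pair n s)

theorem IsSigma3.union {A B : Set ℕ} (hA : IsSigma3 A) (hB : IsSigma3 B) :
    IsSigma3 (A ∪ B) := by
  obtain ⟨R, hR, hA⟩ := hA
  obtain ⟨R', hR', hB⟩ := hB
  obtain ⟨r, hr, hr'⟩ := ComputablePred.computable_iff.1 hR
  obtain ⟨r', hr₂, hr₂'⟩ := ComputablePred.computable_iff.1 hR'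
  have e1 : ∀ x a b c, R x a b c ↔ r (x, a, b, c) = true := fun x a b c =>
    iff_of_eq (congrFun hr' (x, a, b, c))
  have e2 : ∀ x a b c, R' x a b c ↔ r' (x, a, b, c) = true := fun x a b c =>
    iff_of_eq (congrFun hr₂' (x, a, b, c))
  -- The parity of the outer witness says which of the two sets it is for.
  refine ⟨fun x a b c => bif a.bodd then r (x, a.div2, b, c) else r' (x, a.div2, b, c), ?_, ?_⟩
  · refine ComputablePred.computable_iff.2 ⟨_, ?_, rfl⟩
    have ha : Computable fun p : ℕ × ℕ × ℕ × ℕ => p.2.1 := Computable.fst.comp Computable.snd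
    have hq : Computable fun p : ℕ × ℕ × ℕ × ℕ => (p.1, p.2.1.div2, p.2.2.1, p.2.2.2) :=
      Computable.fst.pair ((Primrec.nat_div2.to_comp.comp ha).pair
        (Computable.snd.comp Computable.snd))
    exact Computable.cond (Primrec.nat_bodd.to_comp.comp ha) (hr.comp hq) (hr₂.comp hq)
  · intro x
    rw [Set.mem_union, hA, hB]
    constructor
    · rintro (⟨a, ha⟩ | ⟨a, ha⟩)
      · exact ⟨2 * a + 1, fun b => by simpa [e1, Nat.div2_val, Nat.mul_add_div] using ha b⟩
      · exact ⟨2 * a, fun b => by simpa [e2, Nat.div2_val] using ha b⟩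
    · rintro ⟨a, ha⟩
      cases h : a.bodd
      · exact Or.inr ⟨a.div2, fun b => by simpa [e2, h] using ha b⟩
      · exact Or.inl ⟨a.div2, fun b => by simpa [e1, h] using ha b⟩

/-- Quantification over recursive functions whose values satisfy a limit-decidable condition
stays within `Σ⁰₃`: one guesses a program and asks that each input be found, infinitely often, to
have a value which currently seems to satisfy the condition. -/
theorem isSigma3_exists_computable {q : ℕ → ℕ → ℕ → ℕ → Bool} {Q : ℕ → ℕ → ℕ → Prop}
    (hq : Primrec fun p : ℕ × ℕ × ℕ × ℕ => q p.1 p.2.1 p.2.2.1 p.2.2.2)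
    (hQ : ∀ x n y, ∀ᶠ t in atTop, (q x t n y = true ↔ Q x n y)) :
    IsSigma3 {x | ∃ f : ℕ → ℕ, Computable f ∧ ∀ n, Q x n (f n)} := by
  refine isSigma3_of_frequently (G := fun x a n t =>
    ((Nat.Partrec.Code.evaln t (Denumerable.ofNat Nat.Partrec.Code a) n).map
      fun y => q x t n y).getD false = true) ?_ fun x => ?_
  · have hn : Primrec fun p : ℕ × ℕ × ℕ × ℕ => p.2.2.1 :=
      Primrec.fst.comp (Primrec.snd.comp Primrec.snd)
    have ht : Primrec fun p : ℕ × ℕ × ℕ × ℕ => p.2.2.2 :=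
      Primrec.snd.comp (Primrec.snd.comp Primrec.snd)
    refine Primrec.eq.comp (Primrec.option_getD.comp (Primrec.option_map (primrec_evaln_comp ht
      ((Primrec.ofNat _).comp (Primrec.fst.comp Primrec.snd)) hn) ?_) (Primrec.const false))
      (Primrec.const true)
    exact hq.comp ((Primrec.fst.comp Primrec.fst).pair ((ht.comp Primrec.fst).pair
      ((hn.comp Primrec.fst).pair Primrec.snd)))
  · have key : ∀ (a n t : ℕ),
        ((Nat.Partrec.Code.evaln t (Denumerable.ofNat Nat.Partrec.Code a) n).map
          fun y => q x t n y).getD false = true ↔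
        ∃ y, y ∈ Nat.Partrec.Code.evaln t (Denumerable.ofNat Nat.Partrec.Code a) n ∧
          q x t n y = true := by
      intro a n t
      rcases Nat.Partrec.Code.evaln t (Denumerable.ofNat Nat.Partrec.Code a) n with _ | y <;> simp
    simp only [key]
    constructor
    · rintro ⟨f, hf, hfQ⟩
      obtain ⟨c, hc⟩ := Nat.Partrec.Code.exists_code.1 (Partrec.nat_iff.1 hf.partrec)
      refine ⟨Encodable.encode c, fun n => ?_⟩
      have hmem : f n ∈ c.eval n := by rw [hc]; simp
      obtain ⟨k, hk⟩ := Nat.Partrec.Code.evaln_complete.1 hmem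
      refine Eventually.frequently ?_
      filter_upwards [hQ x n (f n), eventually_ge_atTop k] with t h1 h2
      refine ⟨f n, ?_, h1.2 (hfQ n)⟩
      rw [Denumerable.ofNat_encode]
      exact Nat.Partrec.Code.evaln_mono h2 hk
    · rintro ⟨a, ha⟩
      set c := Denumerable.ofNat Nat.Partrec.Code a
      have htot : ∀ n, ∃ y, y ∈ c.eval n := fun n => by
        obtain ⟨t, y, hy, -⟩ := (ha n).exists
        exact ⟨y, Nat.Partrec.Code.evaln_sound hy⟩
      choose f hf using htot
      refine ⟨f, ?_, fun n => ?_⟩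
      · refine Partrec.of_eq (Partrec.nat_iff.2 (Nat.Partrec.Code.exists_code.2 ⟨c, rfl⟩))
          fun n => ?_
        exact Part.eq_some_iff.2 (hf n)
      · obtain ⟨t, ⟨y, hy, hy'⟩, ht⟩ := ((ha n).and_eventually (hQ x n (f n))).exists
        rw [Part.mem_unique (Nat.Partrec.Code.evaln_sound hy) (hf n)] at hy'
        exact ht.1 hy'

/-! ### Immunity and hyperimmunity through recursive functions -/

/-- The sequence in which every term is the value of `f` at the successor of the preceding one.
If `n ≤ f n ∈ S` for all `n`, it is an increasing sequence in `S`. -/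
def selectorIterate (f : ℕ → ℕ) (n : ℕ) : ℕ :=
  Nat.rec (f 0) (fun _ m => f (m + 1)) n

theorem computable_selectorIterate {f : ℕ → ℕ} (hf : Computable f) :
    Computable (selectorIterate f) :=
  Computable.nat_rec Computable.id (Computable.const (f 0))
    (hf.comp (Computable.succ.comp (Computable.snd.comp Computable.snd))).to₂

theorem strictMono_selectorIterate {f : ℕ → ℕ} (hf : ∀ n, n ≤ f n) :
    StrictMono (selectorIterate f) :=
  strictMono_nat_of_lt_succ fun _ => hf _

theorem selectorIterate_mem {f : ℕ → ℕ} {S : Set ℕ} (hf : ∀ n, f n ∈ S) (n : ℕ) :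
    selectorIterate f n ∈ S := by
  cases n <;> exact hf _

theorem immune_iff {S : Set ℕ} : Immune S ↔ S.Infinite ∧
    ¬ ∃ f : ℕ → ℕ, Computable f ∧ ∀ n, n ≤ f n ∧ f n ∈ S := by
  refine and_congr_right fun _ => not_congr ⟨?_, ?_⟩
  · rintro ⟨R, hRS, hR, hdec⟩
    have hex : ∀ n, ∃ m, n ≤ m ∧ m ∈ R := fun n =>
      let ⟨m, hm, hnm⟩ := hR.exists_gt n
      ⟨m, hnm.le, hm⟩
    classical
    obtain ⟨r, hr, hr'⟩ := ComputablePred.computable_iff.1 hdec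
    have e : ∀ m, m ∈ R ↔ r m = true := fun m => iff_of_eq (congrFun hr' m)
    refine ⟨fun n => Nat.find (hex n), ?_, fun n =>
      ⟨(Nat.find_spec (hex n)).1, hRS (Nat.find_spec (hex n)).2⟩⟩
    refine Computable.find (P := fun n m => n ≤ m ∧ m ∈ R) ?_ hex
    refine ComputablePred.computable_iff.2 ⟨fun p => decide (p.1 ≤ p.2) && r p.2, ?_, ?_⟩
    · exact Primrec.and.to_comp.comp (Primrec.nat_le.decide.to_comp) (hr.comp Computable.snd)
    · funext p
      simp [e]
  · rintro ⟨f, hf, hfS⟩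
    have hmono := strictMono_selectorIterate fun n => (hfS n).1
    refine ⟨Set.range (selectorIterate f), ?_, Set.infinite_range_of_injective hmono.injective, ?_⟩
    · rintro _ ⟨n, rfl⟩
      exact selectorIterate_mem (fun n => (hfS n).2) n
    · have hex : ∀ m, ∃ k, m ≤ selectorIterate f k := fun m => ⟨m, hmono.le_apply⟩
      have hfind : Computable fun m => Nat.find (hex m) := by
        refine Computable.find (P := fun m k => m ≤ selectorIterate f k) ?_ hex
        exact Computable.computablePred (Primrec.nat_le.decide.to_comp.comp Computable.fst
          ((computable_selectorIterate hf).comp Computable.snd))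
      have hdec : Computable fun m =>
          decide (selectorIterate f (Nat.find (hex m)) = m) :=
        Primrec.eq.decide.to_comp.comp ((computable_selectorIterate hf).comp hfind) Computable.id
      refine (Computable.computablePred hdec).of_eq fun m => ⟨fun h => ⟨_, h⟩, ?_⟩
      rintro ⟨k, rfl⟩
      refine le_antisymm (hmono.monotone (Nat.find_min' _ le_rfl)) (Nat.find_spec (hex _))

open Classical in
theorem hyperimmune_iff {S : Set ℕ} : Hyperimmune S ↔ S.Infinite ∧
    ¬ ∃ f : ℕ → ℕ, Computable f ∧ ∀ n, n < Nat.count (fun k => k ∈ S) (f n) :=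
  and_congr_right fun hS => by simp only [Nat.lt_nth_iff_count_lt (p := fun k => k ∈ S) hS]

theorem Hyperimmune.immune {S : Set ℕ} (h : Hyperimmune S) : Immune S := by
  refine immune_iff.2 ⟨h.1, fun ⟨f, hf, hfS⟩ => h.2 ⟨fun n => selectorIterate f n + 1,
    Computable.succ.comp (computable_selectorIterate hf), fun n => Nat.lt_succ_of_le ?_⟩⟩
  classical
  have hmono := strictMono_selectorIterate fun n => (hfS n).1
  rw [← Nat.lt_succ_iff, Nat.succ_eq_add_one,
    ← Nat.lt_nth_iff_count_lt (p := fun k => k ∈ S) h.1]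
  induction n with
  | zero =>
    rw [Nat.count_succ, if_pos (selectorIterate_mem (fun n => (hfS n).2) 0)]
    omega
  | succ n ih =>
    rw [Nat.count_succ, if_pos (selectorIterate_mem (fun n => (hfS n).2) (n + 1))]
    have := Nat.count_monotone (fun k => k ∈ S) (Nat.succ_le_of_lt (hmono (Nat.lt_succ_self n)))
    simp only [Nat.succ_eq_add_one] at this
    omega

theorem Immune.infinite_compl {S : Set ℕ} (h : Immune S) : Sᶜ.Infinite := by
  intro hfin
  obtain ⟨N, hN⟩ := hfin.bddAbove
  refine (immune_iff.1 h).2 ⟨fun n => n + N + 1, ?_, fun n => ⟨?_, ?_⟩⟩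
  · exact (Primrec.succ.comp (Primrec.nat_add.comp Primrec.id (Primrec.const N))).to_comp
  · exact (Nat.le_add_right n N).trans (Nat.le_succ _)
  · by_contra hn
    have : n + N + 1 ≤ N := hN hn
    omega

theorem Immune.infinite_and_compl {S : Set ℕ} (h : Immune S) : S.Infinite ∧ Sᶜ.Infinite :=
  ⟨h.1, h.infinite_compl⟩

/-! ### Index sets of uniformly limit-computable sets -/

/-- The sets `S e` are uniformly the limits of primitive recursive approximations. -/
structure IsUniformLimit (D : ℕ → ℕ → ℕ → Bool) (S : ℕ → Set ℕ) : Prop where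
  primrec : Primrec fun p : ℕ × ℕ × ℕ => D p.1 p.2.1 p.2.2
  limit : ∀ e, IsLimitSet (D e) (S e)

theorem IsUniformLimit.compl {D : ℕ → ℕ → ℕ → Bool} {S : ℕ → Set ℕ} (h : IsUniformLimit D S) :
    IsUniformLimit (fun e s n => !D e s n) fun e => (S e)ᶜ :=
  ⟨Primrec.not.comp h.primrec, fun e => (h.limit e).compl⟩

theorem IsUniformLimit.isSigma3_not_infinite {D : ℕ → ℕ → ℕ → Bool} {S : ℕ → Set ℕ}
    (h : IsUniformLimit D S) : IsSigma3 {e | ¬ (S e).Infinite} := by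
  refine isSigma3_of_frequently (G := fun e a n t => a < n → D e t n = false) ?_ fun e => ?_
  · have hn : Primrec fun p : ℕ × ℕ × ℕ × ℕ => p.2.2.1 :=
      Primrec.fst.comp (Primrec.snd.comp Primrec.snd)
    have ht : Primrec fun p : ℕ × ℕ × ℕ × ℕ => p.2.2.2 :=
      Primrec.snd.comp (Primrec.snd.comp Primrec.snd)
    refine PrimrecPred.of_eq (p := fun p : ℕ × ℕ × ℕ × ℕ =>
      ¬ p.2.1 < p.2.2.1 ∨ D p.1 p.2.2.2 p.2.2.1 = false) ?_ fun p => by tauto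
    refine PrimrecPred.or (Primrec.nat_lt.comp (Primrec.fst.comp Primrec.snd) hn).not ?_
    exact Primrec.eq.comp (h.primrec.comp (Primrec.fst.pair (ht.pair hn))) (Primrec.const false)
  · simp only [Set.mem_ofPred_eq, Set.not_infinite]
    constructor
    · intro hfin
      obtain ⟨N, hN⟩ := hfin.bddAbove
      refine ⟨N, fun n => Eventually.frequently ?_⟩
      filter_upwards [h.limit e n] with t ht hn
      rw [← Bool.not_eq_true, ht]
      exact fun hmem => absurd (hN hmem) (not_le.2 hn)
    · rintro ⟨N, hN⟩
      refine (Set.finite_Iic N).subset fun n hn => ?_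
      by_contra hlt
      obtain ⟨t, h1, h2⟩ := ((hN n).and_eventually (h.limit e n)).exists
      simp [h1 (not_le.1 hlt), hn] at h2

theorem IsUniformLimit.isSigma3_not_immune {D : ℕ → ℕ → ℕ → Bool} {S : ℕ → Set ℕ}
    (h : IsUniformLimit D S) : IsSigma3 {e | ¬ Immune (S e)} := by
  have h1 := isSigma3_exists_computable (q := fun e t n y => decide (n ≤ y) && D e t y)
    (Q := fun e n y => n ≤ y ∧ y ∈ S e) ?_ ?_
  · convert h.isSigma3_not_infinite.union h1 using 1
    ext e
    simp only [immune_iff, Set.mem_ofPred_eq, Set.mem_union]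
    rw [not_and_or, not_not]
  · have hn : Primrec fun p : ℕ × ℕ × ℕ × ℕ => p.2.2.1 :=
      Primrec.fst.comp (Primrec.snd.comp Primrec.snd)
    have hy : Primrec fun p : ℕ × ℕ × ℕ × ℕ => p.2.2.2 :=
      Primrec.snd.comp (Primrec.snd.comp Primrec.snd)
    exact Primrec.and.comp (Primrec.nat_le.decide.comp hn hy)
      (h.primrec.comp (Primrec.fst.pair ((Primrec.fst.comp Primrec.snd).pair hy)))
  · intro e n y
    filter_upwards [h.limit e y] with t ht
    simp [ht]

open Classical in
/-- The number of elements below `y` of a limit is eventually computed by the approximations. -/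
theorem IsLimitSet.eventually_count_eq {D : ℕ → ℕ → Bool} {S : Set ℕ} (h : IsLimitSet D S)
    (y : ℕ) : ∀ᶠ t in atTop,
      ∑ i ∈ Finset.range y, (D t i).toNat = Nat.count (fun k => k ∈ S) y := by
  induction y with
  | zero => simp
  | succ y ih =>
    filter_upwards [ih, h y] with t h1 h2
    rw [Finset.sum_range_succ, h1, Nat.count_succ]
    congr 1
    by_cases hy : y ∈ S
    · simp [hy, h2.2 hy]
    · rw [if_neg hy, Bool.eq_false_iff.2 fun hD => hy (h2.1 hD)]
      rfl

theorem IsUniformLimit.isSigma3_not_hyperimmune {D : ℕ → ℕ → ℕ → Bool} {S : ℕ → Set ℕ}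
    (h : IsUniformLimit D S) : IsSigma3 {e | ¬ Hyperimmune (S e)} := by
  classical
  have h1 := isSigma3_exists_computable
    (q := fun e t n y => decide (n < ∑ i ∈ Finset.range y, (D e t i).toNat))
    (Q := fun e n y => n < Nat.count (fun k => k ∈ S e) y) ?_ ?_
  · convert h.isSigma3_not_infinite.union h1 using 1
    ext e
    simp only [hyperimmune_iff, Set.mem_ofPred_eq, Set.mem_union]
    rw [not_and_or, not_not]
  · have hn : Primrec fun p : ℕ × ℕ × ℕ × ℕ => p.2.2.1 :=
      Primrec.fst.comp (Primrec.snd.comp Primrec.snd)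
    have hy : Primrec fun p : ℕ × ℕ × ℕ × ℕ => p.2.2.2 :=
      Primrec.snd.comp (Primrec.snd.comp Primrec.snd)
    refine Primrec.nat_lt.decide.comp hn (primrec_sum_range hy ?_)
    have hD : Primrec fun p : (ℕ × ℕ × ℕ × ℕ) × ℕ => D p.1.1 p.1.2.1 p.2 :=
      h.primrec.comp ((Primrec.fst.comp Primrec.fst).pair
        ((Primrec.fst.comp (Primrec.snd.comp Primrec.fst)).pair Primrec.snd))
    exact (Primrec.dom_finite Bool.toNat).comp hD
  · intro e n y
    filter_upwards [(h.limit e).eventually_count_eq y] with t ht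
    rw [ht, decide_eq_true_iff]

theorem IsUniformLimit.isSigma3_not_biImmune {D : ℕ → ℕ → ℕ → Bool} {S : ℕ → Set ℕ}
    (h : IsUniformLimit D S) : IsSigma3 {e | ¬ BiImmune (S e)} := by
  convert h.isSigma3_not_immune.union h.compl.isSigma3_not_immune using 1
  ext e
  exact not_and_or

theorem IsUniformLimit.isSigma3_not_biHyperimmune {D : ℕ → ℕ → ℕ → Bool} {S : ℕ → Set ℕ}
    (h : IsUniformLimit D S) : IsSigma3 {e | ¬ BiHyperimmune (S e)} := by
  convert h.isSigma3_not_hyperimmune.union h.compl.isSigma3_not_hyperimmune using 1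
  ext e
  exact not_and_or

/-- The binary expansions of a universal numbering are uniformly limit-computable. -/
theorem IsUniversal.exists_isUniformLimit {α : ℕ → ℝ} (hu : IsUniversal α) :
    ∃ D S, IsUniformLimit D S ∧ ∀ e, IsBinaryExpansion (α e) (S e) := by
  obtain ⟨hC, hrange, φ, hφ, hw⟩ := hu
  obtain ⟨c, hc⟩ := exists_code_of_isNumbering hφ
  have hle : ∀ e, α e ≤ 1 := fun e => (hC (α e) (hrange ▸ Set.mem_range_self e)).1.2
  choose S hS hlim using fun e => (isDyadicApprox_stageApprox hc (hw e) (hle e)).exists_limitSet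
  refine ⟨fun e => dyadicDigit (stageApprox c e), S, ⟨?_, hlim⟩, hS⟩
  have hs : Primrec fun p : ℕ × ℕ × ℕ => p.2.1 := Primrec.fst.comp Primrec.snd
  refine PrimrecPred.decide (Primrec.eq.comp (Primrec.nat_mod.comp ?_ (Primrec.const 2))
    (Primrec.const 1))
  refine Primrec.nat_div.comp (Primrec.nat_mul.comp ?_ ?_) (primrec_two_pow.comp hs)
  · exact (primrec_stageApprox c).comp Primrec.fst hs
  · exact primrec_two_pow.comp (Primrec.succ.comp (Primrec.snd.comp Primrec.snd))

/-! ### A normal form for `Σ⁰₃` sets -/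

/-- For every `b' < b` the program `c` accepts `(x, a, b', k)` within `m` steps for some witness
`k < m`. -/
def AcceptsBelow (c : Nat.Partrec.Code) (x a b m : ℕ) : Prop :=
  ∀ b' < b, ∃ k < m,
    Nat.Partrec.Code.evaln m c (Encodable.encode (x, a, b', k)) = some (Encodable.encode true)

theorem AcceptsBelow.mono {c : Nat.Partrec.Code} {x a b m m' : ℕ} (hm : m ≤ m')
    (h : AcceptsBelow c x a b m) : AcceptsBelow c x a b m' := fun b' hb =>
  let ⟨k, hk, hev⟩ := h b' hb
  ⟨k, hk.trans_le hm, Nat.Partrec.Code.evaln_mono hm hev⟩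

theorem primrecRel_forall_lt_exists_lt {σ : Type} [Primcodable σ] {R : ℕ → ℕ → σ → Prop}
    (h : PrimrecRel fun (k : ℕ) (q : ℕ × σ) => R k q.1 q.2) :
    PrimrecRel fun (b : ℕ) (q : ℕ × σ) => ∀ b' < b, ∃ k < q.1, R k b' q.2 := by
  have h0 : PrimrecRel fun (n : ℕ) (q : ℕ × σ) => ∃ k < n, R k q.1 q.2 := by
    refine PrimrecPred.of_eq (h.exists_mem_list.comp (Primrec.list_range.comp Primrec.fst)
      Primrec.snd) fun p => ?_
    simp only [List.mem_range]
  have h1 : PrimrecPred fun p : ℕ × ℕ × σ => ∃ k < p.2.1, R k p.1 p.2.2 :=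
    h0.comp (Primrec.fst.comp Primrec.snd) (Primrec.fst.pair (Primrec.snd.comp Primrec.snd))
  have h2 : PrimrecRel fun (b' : ℕ) (q : ℕ × σ) => ∃ k < q.1, R k b' q.2 := h1
  refine PrimrecPred.of_eq (h2.forall_mem_list.comp (Primrec.list_range.comp Primrec.fst)
    Primrec.snd) fun p => ?_
  simp only [List.mem_range]

theorem primrecPred_acceptsBelow (c : Nat.Partrec.Code) :
    PrimrecPred fun p : ℕ × ℕ × ℕ × ℕ => AcceptsBelow c p.1 p.2.1 p.2.2.1 p.2.2.2 := by
  have hk : Primrec fun p : ℕ × ℕ × ℕ × ℕ × ℕ =>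
      Nat.Partrec.Code.evaln p.2.2.2.2 c
        (Encodable.encode (p.2.2.1, p.2.2.2.1, p.2.1, p.1)) := by
    have hq : Primrec fun p : ℕ × ℕ × ℕ × ℕ × ℕ => p.2.2 := Primrec.snd.comp Primrec.snd
    exact primrec_evaln_comp (Primrec.snd.comp (Primrec.snd.comp hq)) (Primrec.const c)
      (Primrec.encode.comp ((Primrec.fst.comp hq).pair
        ((Primrec.fst.comp (Primrec.snd.comp hq)).pair
          ((Primrec.fst.comp Primrec.snd).pair Primrec.fst))))
  have h1 := primrecRel_forall_lt_exists_lt (σ := ℕ × ℕ × ℕ) (R := fun k b' q =>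
    Nat.Partrec.Code.evaln q.2.2 c (Encodable.encode (q.1, q.2.1, b', k))
      = some (Encodable.encode true)) (Primrec.eq.comp hk (Primrec.const _))
  have ha : Primrec fun p : ℕ × ℕ × ℕ × ℕ => p.2.1 := Primrec.fst.comp Primrec.snd
  have hb : Primrec fun p : ℕ × ℕ × ℕ × ℕ => p.2.2.1 :=
    Primrec.fst.comp (Primrec.snd.comp Primrec.snd)
  have hm : Primrec fun p : ℕ × ℕ × ℕ × ℕ => p.2.2.2 :=
    Primrec.snd.comp (Primrec.snd.comp Primrec.snd)
  exact h1.comp hb (hm.pair (Primrec.fst.pair (ha.pair hm)))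

/-- Membership in a `Σ⁰₃` set means that, for some `a`, an event which can be checked primitive
recursively occurs infinitely often. The events for `a` are the pairs `(b, m)` such that `m` is
the first stage at which all `b' < b` have been accepted. -/
theorem IsSigma3.exists_event {A : Set ℕ} (hA : IsSigma3 A) :
    ∃ E : ℕ → ℕ → ℕ → Prop, PrimrecPred (fun p : ℕ × ℕ × ℕ => E p.1 p.2.1 p.2.2) ∧
      ∀ x, x ∈ A ↔ ∃ a, ∃ᶠ s in atTop, E x a s := by
  obtain ⟨R, hR, hA⟩ := hA
  obtain ⟨r, hr, hr'⟩ := ComputablePred.computable_iff.1 hR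
  have e1 : ∀ x a b k, R x a b k ↔ r (x, a, b, k) = true := fun x a b k =>
    iff_of_eq (congrFun hr' (x, a, b, k))
  obtain ⟨c, hc⟩ := Nat.Partrec.Code.exists_code.1 hr
  have hev : ∀ x a b k, R x a b k ↔ ∃ m, Nat.Partrec.Code.evaln m c
      (Encodable.encode (x, a, b, k)) = some (Encodable.encode true) := by
    intro x a b k
    rw [e1]
    refine Iff.trans ?_ (Nat.Partrec.Code.evaln_complete (c := c)
      (n := Encodable.encode (x, a, b, k)) (x := Encodable.encode true))
    rw [hc]
    simp only [Encodable.encodek, Part.coe_some, Part.bind_some, PFun.coe_val, Part.map_some,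
      Part.mem_some_iff]
    exact ⟨fun h => by rw [h], fun h => (Encodable.encode_injective h).symm⟩
  refine ⟨fun x a s => AcceptsBelow c x a s.unpair.1 s.unpair.2 ∧
    (s.unpair.2 = 0 ∨ ¬ AcceptsBelow c x a s.unpair.1 (s.unpair.2 - 1)), ?_, fun x => ?_⟩
  · have hb : Primrec fun p : ℕ × ℕ × ℕ => p.2.2.unpair.1 :=
      Primrec.fst.comp (Primrec.unpair.comp (Primrec.snd.comp Primrec.snd))
    have hm : Primrec fun p : ℕ × ℕ × ℕ => p.2.2.unpair.2 :=
      Primrec.snd.comp (Primrec.unpair.comp (Primrec.snd.comp Primrec.snd))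
    have ha : Primrec fun p : ℕ × ℕ × ℕ => p.2.1 := Primrec.fst.comp Primrec.snd
    refine PrimrecPred.and ((primrecPred_acceptsBelow c).comp
      (Primrec.fst.pair (ha.pair (hb.pair hm)))) (PrimrecPred.or ?_ (PrimrecPred.not ?_))
    · exact Primrec.eq.comp hm (Primrec.const 0)
    · exact (primrecPred_acceptsBelow c).comp (Primrec.fst.pair (ha.pair (hb.pair
        (Primrec.nat_sub.comp hm (Primrec.const 1)))))
  · rw [hA]
    refine exists_congr fun a => ?_
    rw [Nat.frequently_atTop_iff_infinite]
    constructor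
    · intro h
      have hex : ∀ b, ∃ m, AcceptsBelow c x a b m := by
        intro b
        induction b with
        | zero => exact ⟨0, fun b' hb => absurd hb (Nat.not_lt_zero _)⟩
        | succ b ih =>
          obtain ⟨m, hm⟩ := ih
          obtain ⟨k, hk⟩ := h b
          obtain ⟨m', hm'⟩ := (hev x a b k).1 hk
          refine ⟨max m (max m' (k + 1)), fun b' hb => ?_⟩
          rcases Nat.lt_succ_iff_lt_or_eq.1 hb with hb | rfl
          · exact (hm.mono (le_max_left _ _)) b' hb
          · exact ⟨k, by omega, Nat.Partrec.Code.evaln_mono (by omega) hm'⟩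
      classical
      refine Set.infinite_of_injective_forall_mem (f := fun b => Nat.pair b (Nat.find (hex b)))
        (fun b b' hbb => (Nat.pair_eq_pair.1 hbb).1) fun b => ?_
      simp only [Set.mem_ofPred_eq, Nat.unpair_pair]
      refine ⟨Nat.find_spec (hex b), ?_⟩
      rw [or_iff_not_imp_left]
      exact fun h0 => Nat.find_min (hex b) (Nat.sub_lt (Nat.pos_of_ne_zero h0) one_pos)
    · intro hinf
      by_contra hcon
      push Not at hcon
      obtain ⟨b₀, hb₀⟩ := hcon
      refine hinf (((Set.finite_Iic b₀).biUnion (t := fun b => {s : ℕ | s.unpair.1 = b ∧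
        AcceptsBelow c x a b s.unpair.2 ∧
        (s.unpair.2 = 0 ∨ ¬ AcceptsBelow c x a b (s.unpair.2 - 1))}) ?_).subset ?_)
      · refine fun b _ => Set.Subsingleton.finite ?_
        have hle : ∀ m m', AcceptsBelow c x a b m →
            (m' = 0 ∨ ¬ AcceptsBelow c x a b (m' - 1)) → m' ≤ m := by
          intro m m' hm hm'
          by_contra hlt
          rcases hm' with rfl | hm'
          · omega
          · exact hm' (hm.mono (by omega))
        rintro s ⟨hs1, hs2, hs3⟩ s' ⟨hs1', hs2', hs3'⟩
        rw [← Nat.pair_unpair s, ← Nat.pair_unpair s', hs1, hs1',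
          le_antisymm (hle _ _ hs2' hs3) (hle _ _ hs2 hs3')]
      · rintro s ⟨hs, hs'⟩
        simp only [Set.mem_iUnion]
        refine ⟨s.unpair.1, ?_, rfl, hs, hs'⟩
        by_contra hlt
        obtain ⟨k, -, hk⟩ := hs b₀ (not_le.1 hlt)
        exact hb₀ k ((hev x a b₀ k).2 ⟨_, hk⟩)

/-! ### Truncations of digit sequences -/

/-- The number with the binary digits `f 0, …, f (n - 1)`, most significant digit first. -/
def truncValue (f : ℕ → Bool) (n : ℕ) : ℕ :=
  Nat.rec 0 (fun i r => 2 * r + (f i).toNat) n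

theorem truncValue_succ (f : ℕ → Bool) (n : ℕ) :
    truncValue f (n + 1) = 2 * truncValue f n + (f n).toNat := rfl

theorem truncValue_lt (f : ℕ → Bool) (n : ℕ) : truncValue f n < 2 ^ n := by
  induction n with
  | zero => simp [truncValue]
  | succ n ih =>
    have := Bool.toNat_lt (f n)
    rw [truncValue_succ, pow_succ']
    omega

theorem truncValue_le_of_le {f g : ℕ → Bool} (h : ∀ i, f i ≤ g i) (n : ℕ) :
    truncValue f n ≤ truncValue g n := by
  induction n with
  | zero => exact le_rfl
  | succ n ih =>
    have : (f n).toNat ≤ (g n).toNat := by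
      have := h n
      revert this
      cases f n <;> cases g n <;> decide
    rw [truncValue_succ, truncValue_succ]
    omega

theorem truncValue_congr {f g : ℕ → Bool} {n : ℕ} (h : ∀ i < n, f i = g i) :
    truncValue f n = truncValue g n := by
  induction n with
  | zero => rfl
  | succ n ih =>
    rw [truncValue_succ, truncValue_succ, ih fun i hi => h i (by omega), h n (Nat.lt_succ_self n)]

theorem truncValue_le_of_lex {f g : ℕ → Bool} {p : ℕ} (h : ∀ i < p, f i = g i)
    (hf : f p = false) (hg : g p = true) (n : ℕ) : truncValue f n ≤ truncValue g n := by
  rcases le_or_gt n p with hn | hn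
  · exact (truncValue_congr fun i hi => h i (hi.trans_le hn)).le
  · suffices truncValue f n + 1 ≤ truncValue g n by omega
    induction n, Nat.succ_le_of_lt hn using Nat.le_induction with
    | base => simp [truncValue_succ, truncValue_congr h, hf, hg]
    | succ n hpn ih =>
      have := ih hpn
      have := Bool.toNat_lt (f n)
      rw [truncValue_succ, truncValue_succ]
      omega

theorem truncValue_div_two_pow (f : ℕ → Bool) {n m : ℕ} (h : n ≤ m) :
    truncValue f m / 2 ^ (m - n) = truncValue f n := by
  induction m, h using Nat.le_induction with
  | base => simp
  | succ m hnm ih =>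
    have := Bool.toNat_lt (f m)
    rw [Nat.sub_add_comm hnm, pow_succ', ← Nat.div_div_eq_div_mul, truncValue_succ,
      show (2 * truncValue f m + (f m).toNat) / 2 = truncValue f m by omega, ih]

theorem dyadicDigit_truncValue (F : ℕ → ℕ → Bool) {s n : ℕ} (h : n < s) :
    dyadicDigit (fun s => truncValue (F s) s) s n = F s n := by
  have h1 : truncValue (F s) s * 2 ^ (n + 1) / 2 ^ s = truncValue (F s) (n + 1) := by
    rw [← truncValue_div_two_pow (F s) (Nat.succ_le_of_lt h)]
    have h2 : 2 ^ s = 2 ^ (s - (n + 1)) * 2 ^ (n + 1) := by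
      rw [← pow_add, Nat.sub_add_cancel (Nat.succ_le_of_lt h)]
    rw [h2, Nat.mul_div_mul_right _ _ (Nat.two_pow_pos _)]
  simp only [dyadicDigit, h1, truncValue_succ]
  cases F s n <;> simp

/-- Digit sequences whose truncations do not decrease give approximations of some number from
below. -/
theorem exists_isDyadicApprox {F : ℕ → ℕ → Bool}
    (hF : ∀ s n, truncValue (F s) n ≤ truncValue (F (s + 1)) n) :
    ∃ X, IsDyadicApprox (fun s => truncValue (F s) s) X := by
  have hm : ∀ s, 2 * truncValue (F s) s ≤ truncValue (F (s + 1)) (s + 1) := fun s =>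
    (Nat.le_add_right _ _).trans (hF s (s + 1))
  refine ⟨_, fun s => truncValue_lt _ _, hm, tendsto_atTop_ciSup (monotone_nat_of_le_succ ?_) ?_⟩
  · intro s
    rw [div_le_div_iff₀ (by positivity) (by positivity), pow_succ']
    have h1 : (2 * truncValue (F s) s : ℝ) ≤ truncValue (F (s + 1)) (s + 1) := by
      exact_mod_cast hm s
    have h2 : (0 : ℝ) < 2 ^ s := by positivity
    nlinarith
  · refine ⟨1, ?_⟩
    rintro _ ⟨s, rfl⟩
    simp only
    rw [div_le_one (by positivity)]
    exact_mod_cast (truncValue_lt (F s) s).le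

/-! ### A gap criterion for bi-hyperimmunity -/

theorem hyperimmune_of_gaps {T : Set ℕ} (hT : T.Infinite)
    (h : ∀ f : ℕ → ℕ, Computable f → ∃ q, ∀ i < f q, q + i ∉ T) : Hyperimmune T := by
  refine ⟨hT, fun ⟨f, hf, hlt⟩ => ?_⟩
  obtain ⟨q, hq⟩ := h f hf
  classical
  have h1 := (Nat.lt_nth_iff_count_lt (p := fun k => k ∈ T) hT).2 (hlt q)
  have h2 := Nat.count_monotone (fun k => k ∈ T) (Nat.le_add_left (f q) q)
  rw [Nat.count_add, Nat.count_iff_forall_not.2 hq] at h2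
  have h3 : Nat.count (fun k => k ∈ T) q ≤ q := Nat.count_le _
  omega

/-- The blocks produced by the construction: a block of `0`s, which is long compared to its
starting position, followed by a block of `1`s, which is long compared to its own. -/
theorem biHyperimmune_of_blocks {S : Set ℕ}
    (h : ∀ f : ℕ → ℕ, Computable f → ∃ p, (∀ i < f (p + 1), p + 1 + i ∉ S) ∧
      ∀ i < f (p + 1 + f (p + 1)), p + 1 + f (p + 1) + i ∈ S) : BiHyperimmune S := by
  have hinf : ∀ N, (∃ n ∈ S, N < n) ∧ ∃ n ∈ Sᶜ, N < n := fun N => by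
    obtain ⟨p, h0, h1⟩ := h (fun _ => N + 1) (Computable.const _)
    exact ⟨⟨_, h1 N (Nat.lt_succ_self N), by omega⟩, ⟨_, h0 N (Nat.lt_succ_self N), by omega⟩⟩
  refine ⟨hyperimmune_of_gaps (Set.infinite_of_forall_exists_gt fun N => (hinf N).1)
    fun f hf => ?_, hyperimmune_of_gaps (Set.infinite_of_forall_exists_gt fun N => (hinf N).2)
    fun f hf => ?_⟩
  · obtain ⟨p, hp, -⟩ := h f hf
    exact ⟨p + 1, hp⟩
  · obtain ⟨p, -, hp⟩ := h f hf
    exact ⟨p + 1 + f (p + 1), fun i hi hmem => hmem (hp i hi)⟩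

/-! ### The zone construction -/

/-- The starting position of the `k`-th zone. -/
def zoneStart (l : List (List Bool)) (k : ℕ) : ℕ := (l.take k).flatten.length

/-- The `k`-th zone, empty if it does not exist. -/
def zone (l : List (List Bool)) (k : ℕ) : List Bool := l.getD k []

/-- The infinite digit sequence of a list of zones, continued by zeros. -/
def zoneDigit (l : List (List Bool)) (i : ℕ) : Bool := l.flatten.getD i false

/-- A `1`, then a block of `v` zeros, then a block of `w` ones. -/
def twoBlocks (v w : ℕ) : List Bool := true :: (List.replicate v false ++ List.replicate w true)

/-- The block pattern against the program `c` in a zone starting at `p`, if the two values on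
which it depends have been computed within `s` steps. -/
def blockPattern (c : Nat.Partrec.Code) (p s : ℕ) : Option (List Bool) :=
  (Nat.Partrec.Code.evaln s c (p + 1)).bind fun v =>
    (Nat.Partrec.Code.evaln s c (p + 1 + v)).map fun w => twoBlocks v w

/-- The new contents which the `k`-th zone demands at stage `s`, if it demands attention. A zone
is opened with a single `0`. The zone `2 * e + 1` works once against the `e`-th program; the zone
`2 * a` is filled with ones, beyond all digits in use, whenever the event for `a` occurs. -/
def demand (E : ℕ → ℕ → ℕ → Bool) (x s k : ℕ) (l : List (List Bool)) : Option (List Bool) :=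
  if zone l k = [] then some [false]
  else bif k.bodd then
    if zone l k = [false] then
      blockPattern (Denumerable.ofNat Nat.Partrec.Code k.div2) (zoneStart l k) s
    else none
  else bif E x k.div2 s then some (List.replicate (l.flatten.length + 1) true) else none

/-- The first zone which demands attention at stage `s`. -/
def activeZone (E : ℕ → ℕ → ℕ → Bool) (x s : ℕ) (l : List (List Bool)) : ℕ :=
  (List.range (l.length + 1)).findIdx fun k => (demand E x s k l).isSome

/-- The first zone demanding attention receives its new contents, and all later zones are
discarded. -/
def nextZones (E : ℕ → ℕ → ℕ → Bool) (x s : ℕ) (l : List (List Bool)) : List (List Bool) :=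
  l.take (activeZone E x s l) ++ [(demand E x s (activeZone E x s l) l).getD []]

/-- The list of zones at stage `s` of the construction for `x`. -/
def zonesAt (E : ℕ → ℕ → ℕ → Bool) (x s : ℕ) : List (List Bool) :=
  Nat.rec [] (fun s l => nextZones E x s l) s

theorem zonesAt_succ (E : ℕ → ℕ → ℕ → Bool) (x s : ℕ) :
    zonesAt E x (s + 1) = nextZones E x s (zonesAt E x s) := rfl

/-! ### The construction is primitive recursive -/

theorem primrec_replicate (b : Bool) : Primrec fun n => List.replicate n b :=
  (Primrec.list_map (g := fun _ _ => b) Primrec.list_range (Primrec.const b)).of_eq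
    fun n => by simp

theorem primrec_twoBlocks : Primrec₂ twoBlocks :=
  Primrec.list_cons.comp (Primrec.const true) (Primrec.list_append.comp
    ((primrec_replicate false).comp Primrec.fst) ((primrec_replicate true).comp Primrec.snd))

theorem primrec_blockPattern :
    Primrec fun q : Nat.Partrec.Code × ℕ × ℕ => blockPattern q.1 q.2.1 q.2.2 := by
  have hp : Primrec fun q : Nat.Partrec.Code × ℕ × ℕ => q.2.1 := Primrec.fst.comp Primrec.snd
  have hs : Primrec fun q : Nat.Partrec.Code × ℕ × ℕ => q.2.2 := Primrec.snd.comp Primrec.snd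
  refine Primrec.option_bind (primrec_evaln_comp hs Primrec.fst (Primrec.succ.comp hp)) ?_
  refine Primrec.option_map (primrec_evaln_comp (hs.comp Primrec.fst)
    (Primrec.fst.comp Primrec.fst) (Primrec.nat_add.comp
      (Primrec.succ.comp (hp.comp Primrec.fst)) Primrec.snd)) ?_
  exact primrec_twoBlocks.comp (Primrec.snd.comp Primrec.fst) Primrec.snd

theorem primrec_demand {E : ℕ → ℕ → ℕ → Bool}
    (hE : Primrec fun p : ℕ × ℕ × ℕ => E p.1 p.2.1 p.2.2) :
    Primrec fun q : ℕ × ℕ × ℕ × List (List Bool) => demand E q.1 q.2.1 q.2.2.1 q.2.2.2 := by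
  have hs : Primrec fun q : ℕ × ℕ × ℕ × List (List Bool) => q.2.1 := Primrec.fst.comp Primrec.snd
  have hk : Primrec fun q : ℕ × ℕ × ℕ × List (List Bool) => q.2.2.1 :=
    Primrec.fst.comp (Primrec.snd.comp Primrec.snd)
  have hl : Primrec fun q : ℕ × ℕ × ℕ × List (List Bool) => q.2.2.2 :=
    Primrec.snd.comp (Primrec.snd.comp Primrec.snd)
  have hz : Primrec fun q : ℕ × ℕ × ℕ × List (List Bool) => zone q.2.2.2 q.2.2.1 :=
    (Primrec.list_getD []).comp hl hk
  have hp : Primrec fun q : ℕ × ℕ × ℕ × List (List Bool) => zoneStart q.2.2.2 q.2.2.1 :=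
    Primrec.list_length.comp (Primrec.list_flatten.comp (Primrec.list_take.comp hk hl))
  have hd : Primrec fun q : ℕ × ℕ × ℕ × List (List Bool) => q.2.2.1.div2 :=
    Primrec.nat_div2.comp hk
  refine Primrec.ite (Primrec.eq.comp hz (Primrec.const [])) (Primrec.const _)
    (Primrec.cond (Primrec.nat_bodd.comp hk) ?_ ?_)
  · exact Primrec.ite (Primrec.eq.comp hz (Primrec.const [false]))
      (primrec_blockPattern.comp (((Primrec.ofNat _).comp hd).pair (hp.pair hs)))
      (Primrec.const none)
  · exact Primrec.cond (hE.comp (Primrec.fst.pair (hd.pair hs)))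
      (Primrec.option_some.comp ((primrec_replicate true).comp (Primrec.succ.comp
        (Primrec.list_length.comp (Primrec.list_flatten.comp hl))))) (Primrec.const none)

theorem primrec_zonesAt {E : ℕ → ℕ → ℕ → Bool}
    (hE : Primrec fun p : ℕ × ℕ × ℕ => E p.1 p.2.1 p.2.2) : Primrec₂ (zonesAt E) := by
  have hl : Primrec fun q : ℕ × ℕ × List (List Bool) => q.2.2 := Primrec.snd.comp Primrec.snd
  have hs : Primrec fun q : ℕ × ℕ × List (List Bool) => q.2.1 := Primrec.fst.comp Primrec.snd
  have ha : Primrec fun q : ℕ × ℕ × List (List Bool) => activeZone E q.1 q.2.1 q.2.2 := by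
    refine Primrec.list_findIdx (Primrec.list_range.comp (Primrec.succ.comp
      (Primrec.list_length.comp hl))) ?_
    exact Primrec.option_isSome.comp ((primrec_demand hE).comp
      ((Primrec.fst.comp Primrec.fst).pair ((hs.comp Primrec.fst).pair
        (Primrec.snd.pair (hl.comp Primrec.fst)))))
  have hn : Primrec fun q : ℕ × ℕ × List (List Bool) => nextZones E q.1 q.2.1 q.2.2 :=
    Primrec.list_append.comp (Primrec.list_take.comp ha hl) (Primrec.list_cons.comp
      (Primrec.option_getD.comp ((primrec_demand hE).comp
        (Primrec.fst.pair (hs.pair (ha.pair hl)))) (Primrec.const [])) (Primrec.const []))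
  exact Primrec.nat_rec (f := fun _ : ℕ => []) (g := fun x p => nextZones E x p.1 p.2)
    (Primrec.const []) hn

theorem primrec_truncValue {σ : Type*} [Primcodable σ] {F : σ → ℕ → Bool} {n : σ → ℕ}
    (hF : Primrec₂ F) (hn : Primrec n) : Primrec fun a => truncValue (F a) (n a) := by
  have hb : Primrec fun r : σ × ℕ × ℕ => (F r.1 r.2.1).toNat :=
    (Primrec.dom_finite Bool.toNat).comp
      (Primrec₂.comp hF Primrec.fst (Primrec.fst.comp Primrec.snd))
  have hg : Primrec₂ fun (a : σ) (q : ℕ × ℕ) => 2 * q.2 + (F a q.1).toNat :=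
    Primrec.nat_add.comp (Primrec.nat_mul.comp (Primrec.const 2)
      (Primrec.snd.comp Primrec.snd)) hb
  exact Primrec.nat_rec' hn (Primrec.const 0) hg

theorem primrec_truncValue_zonesAt {E : ℕ → ℕ → ℕ → Bool}
    (hE : Primrec fun p : ℕ × ℕ × ℕ => E p.1 p.2.1 p.2.2) :
    Primrec₂ fun x s => truncValue (zoneDigit (zonesAt E x s)) s := by
  have hz : Primrec fun p : ℕ × ℕ => (zonesAt E p.1 p.2).flatten :=
    Primrec.list_flatten.comp (primrec_zonesAt hE)
  have hF : Primrec₂ fun (p : ℕ × ℕ) (i : ℕ) => zoneDigit (zonesAt E p.1 p.2) i :=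
    (Primrec.list_getD false).comp (hz.comp Primrec.fst) Primrec.snd
  exact primrec_truncValue hF Primrec.snd

/-! ### One step of the construction -/

section Lists

variable {l l' : List (List Bool)} {k i : ℕ}

theorem zoneDigit_of_lt_zoneStart (h : l.take k = l'.take k) (hi : i < zoneStart l k) :
    zoneDigit l i = zoneDigit l' i := by
  have key : ∀ m : List (List Bool), i < (m.take k).flatten.length →
      zoneDigit m i = (m.take k).flatten.getD i false := fun m hm => by
    conv_lhs => rw [zoneDigit, ← List.take_append_drop k m, List.flatten_append]
    exact List.getD_append _ _ _ _ hm
  rw [key l hi, key l' (h ▸ hi), h]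

theorem zoneDigit_zoneStart_add (hi : i < (zone l k).length) :
    zoneDigit l (zoneStart l k + i) = (zone l k).getD i false := by
  have hk : k < l.length := by
    by_contra hk
    rw [zone, List.getD_eq_default _ _ (not_lt.1 hk)] at hi
    simp at hi
  rw [zone, List.getD_eq_getElem _ _ hk] at hi ⊢
  have hsplit : l.flatten = (l.take k).flatten ++ (l.drop k).flatten := by
    rw [← List.flatten_append, List.take_append_drop]
  rw [zoneDigit, zoneStart, hsplit, List.getD_append_right _ _ _ _ (Nat.le_add_right _ _),
    Nat.add_sub_cancel_left, List.drop_eq_getElem_cons hk, List.flatten_cons]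
  exact List.getD_append _ _ _ _ hi

theorem zoneDigit_of_length_le (h : l.flatten.length ≤ i) : zoneDigit l i = false :=
  List.getD_eq_default _ _ h

theorem zoneStart_add_length_le (hk : k < l.length) :
    zoneStart l k + (zone l k).length ≤ l.flatten.length := by
  conv_rhs => rw [← List.take_append_drop k l, List.flatten_append, List.length_append,
    List.drop_eq_getElem_cons hk, List.flatten_cons, List.length_append]
  rw [zone, List.getD_eq_getElem _ _ hk, zoneStart]
  omega

end Lists

section Step

variable {E : ℕ → ℕ → ℕ → Bool} {x s k : ℕ} {l : List (List Bool)}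

theorem isSome_demand_length : (demand E x s l.length l).isSome = true := by
  simp [demand, zone]

theorem activeZone_lt : activeZone E x s l < (List.range (l.length + 1)).length :=
  List.findIdx_lt_length_of_exists ⟨l.length, by simp, isSome_demand_length⟩

theorem activeZone_le_length : activeZone E x s l ≤ l.length := by
  have := activeZone_lt (E := E) (x := x) (s := s) (l := l)
  rw [List.length_range] at this
  omega

theorem isSome_demand_activeZone : (demand E x s (activeZone E x s l) l).isSome = true := by
  have := List.findIdx_getElem (w := activeZone_lt (E := E) (x := x) (s := s) (l := l))
  exact (congrArg (fun k => (demand E x s k l).isSome)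
    (List.getElem_range activeZone_lt)).symm.trans this

theorem activeZone_le (h : (demand E x s k l).isSome = true) : activeZone E x s l ≤ k := by
  by_contra hlt
  have h1 := List.not_of_lt_findIdx (xs := List.range (l.length + 1))
    (p := fun k => (demand E x s k l).isSome) (i := k) (not_le.1 hlt)
  simp [h] at h1

theorem demand_activeZone : demand E x s (activeZone E x s l) l =
    some ((demand E x s (activeZone E x s l) l).getD []) := by
  obtain ⟨z, hz⟩ := Option.isSome_iff_exists.1
    (isSome_demand_activeZone (E := E) (x := x) (s := s) (l := l))
  rw [hz]
  rfl

theorem length_nextZones : (nextZones E x s l).length = activeZone E x s l + 1 := by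
  simp [nextZones, activeZone_le_length]

theorem take_nextZones (h : k ≤ activeZone E x s l) : (nextZones E x s l).take k = l.take k := by
  rw [nextZones, List.take_append_of_le_length (by simp [activeZone_le_length, h]),
    List.take_take, min_eq_left h]

theorem zoneStart_nextZones (h : k ≤ activeZone E x s l) :
    zoneStart (nextZones E x s l) k = zoneStart l k := by
  rw [zoneStart, take_nextZones h, zoneStart]

theorem zone_nextZones_of_lt (h : k < activeZone E x s l) :
    zone (nextZones E x s l) k = zone l k := by
  have hk : k < (l.take (activeZone E x s l)).length := by
    simpa [activeZone_le_length] using h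
  have hk' : k < l.length := h.trans_le activeZone_le_length
  rw [zone, nextZones, List.getD_append _ _ _ _ hk, zone, List.getD_eq_getElem _ _ hk,
    List.getD_eq_getElem _ _ hk', List.getElem_take]

theorem zone_nextZones_activeZone : zone (nextZones E x s l) (activeZone E x s l) =
    (demand E x s (activeZone E x s l) l).getD [] := by
  rw [zone, nextZones, List.getD_append_right _ _ _ _ (by simp)]
  simp [activeZone_le_length]

/-- The possible contents of the `k`-th zone, starting at `p`. -/
def IsZoneContents (k p : ℕ) (z : List Bool) : Prop :=
  z = [false] ∨ (k.bodd = false ∧ ∃ n, z = List.replicate (n + 1) true) ∨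
    (k.bodd = true ∧ ∃ v w, v ∈ (Denumerable.ofNat Nat.Partrec.Code k.div2).eval (p + 1) ∧
      w ∈ (Denumerable.ofNat Nat.Partrec.Code k.div2).eval (p + 1 + v) ∧ z = twoBlocks v w)

theorem IsZoneContents.ne_nil {k p : ℕ} {z : List Bool} (h : IsZoneContents k p z) : z ≠ [] := by
  rintro rfl
  simp [IsZoneContents, twoBlocks] at h

theorem mem_blockPattern {c : Nat.Partrec.Code} {p s : ℕ} {z : List Bool}
    (h : blockPattern c p s = some z) : ∃ v w, v ∈ c.eval (p + 1) ∧ w ∈ c.eval (p + 1 + v) ∧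
      z = twoBlocks v w := by
  simp only [blockPattern, Option.bind_eq_some_iff, Option.map_eq_some_iff] at h
  obtain ⟨v, hv, w, hw, rfl⟩ := h
  exact ⟨v, w, Nat.Partrec.Code.evaln_sound hv, Nat.Partrec.Code.evaln_sound hw, rfl⟩

theorem isZoneContents_of_demand {z : List Bool} (h : demand E x s k l = some z) :
    IsZoneContents k (zoneStart l k) z := by
  by_cases h0 : zone l k = []
  · rw [demand, if_pos h0] at h
    exact Or.inl (Option.some.inj h).symm
  · rw [demand, if_neg h0] at h
    refine Or.inr ?_
    cases hk : k.bodd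
    · rw [hk, cond_false] at h
      cases hE : E x k.div2 s
      · simp [hE] at h
      · rw [hE, cond_true] at h
        exact Or.inl ⟨rfl, _, (Option.some.inj h).symm⟩
    · rw [hk, cond_true] at h
      by_cases h1 : zone l k = [false]
      · rw [if_pos h1] at h
        exact Or.inr ⟨rfl, mem_blockPattern h⟩
      · simp [h1] at h

/-- All zones have possible contents. -/
def IsZoneList (l : List (List Bool)) : Prop :=
  ∀ k < l.length, IsZoneContents k (zoneStart l k) (zone l k)

theorem IsZoneList.nextZones (hl : IsZoneList l) : IsZoneList (nextZones E x s l) := by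
  intro k hk
  rw [length_nextZones, Nat.lt_succ_iff] at hk
  rw [zoneStart_nextZones hk]
  rcases hk.eq_or_lt with rfl | hlt
  · rw [zone_nextZones_activeZone]
    exact isZoneContents_of_demand demand_activeZone
  · rw [zone_nextZones_of_lt hlt]
    exact hl k (hlt.trans_le activeZone_le_length)

theorem isZoneList_zonesAt (E : ℕ → ℕ → ℕ → Bool) (x s : ℕ) : IsZoneList (zonesAt E x s) := by
  induction s with
  | zero => exact fun k hk => absurd hk (Nat.not_lt_zero _)
  | succ s ih => exact ih.nextZones

theorem IsZoneList.zone_ne_nil (hl : IsZoneList l) (hk : k < l.length) : zone l k ≠ [] :=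
  (hl k hk).ne_nil

theorem demand_of_event (hl : IsZoneList l) (hk : k < l.length) (hb : k.bodd = false)
    (hE : E x k.div2 s = true) :
    demand E x s k l = some (List.replicate (l.flatten.length + 1) true) := by
  simp [demand, hl.zone_ne_nil hk, hb, hE]

theorem demand_of_not_event (hl : IsZoneList l) (hk : k < l.length) (hb : k.bodd = false)
    (hE : E x k.div2 s = false) : demand E x s k l = none := by
  simp [demand, hl.zone_ne_nil hk, hb, hE]

theorem demand_of_bodd_of_ne (hl : IsZoneList l) (hk : k < l.length) (hb : k.bodd = true)
    (hz : zone l k ≠ [false]) : demand E x s k l = none := by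
  simp [demand, hl.zone_ne_nil hk, hb, hz]

theorem demand_of_bodd_of_eq (hb : k.bodd = true) (hz : zone l k = [false]) :
    demand E x s k l =
      blockPattern (Denumerable.ofNat Nat.Partrec.Code k.div2) (zoneStart l k) s := by
  simp [demand, hb, hz]

theorem lt_activeZone_of_demand_eq_none (hk : k ≤ activeZone E x s l)
    (h : demand E x s k l = none) : k < activeZone E x s l := by
  refine lt_of_le_of_ne hk ?_
  rintro rfl
  have := isSome_demand_activeZone (E := E) (x := x) (s := s) (l := l)
  simp [h] at this

/-- A step does not decrease the number coded by the zones: opening a zone changes no digit,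
filling with ones reaches beyond all digits in use, and a block pattern turns the first digit of
its zone from `0` to `1`. -/
theorem truncValue_nextZones_le (hl : IsZoneList l) (n : ℕ) :
    truncValue (zoneDigit l) n ≤ truncValue (zoneDigit (nextZones E x s l)) n := by
  set K := activeZone E x s l with hK
  have hzone : zone (nextZones E x s l) K = (demand E x s K l).getD [] := zone_nextZones_activeZone
  have hstart : zoneStart (nextZones E x s l) K = zoneStart l K := zoneStart_nextZones le_rfl
  have hpre : ∀ i < zoneStart l K, zoneDigit l i = zoneDigit (nextZones E x s l) i := fun i hi =>
    zoneDigit_of_lt_zoneStart (take_nextZones le_rfl).symm hi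
  have hdem := demand_activeZone (E := E) (x := x) (s := s) (l := l)
  rw [← hK] at hdem
  by_cases hlen : K < l.length
  · cases hb : K.bodd
    · have hE : E x K.div2 s = true := by
        by_contra hE
        rw [demand_of_not_event hl hlen hb (by simpa using hE)] at hdem
        simp at hdem
      rw [demand_of_event hl hlen hb hE, Option.getD_some] at hzone
      refine truncValue_le_of_le (fun i => ?_) n
      rcases lt_or_ge i (zoneStart l K) with hi | hi
      · exact (hpre i hi).le
      · rcases lt_or_ge i l.flatten.length with hi' | hi'
        · obtain ⟨j, rfl⟩ := Nat.exists_eq_add_of_le hi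
          have h1 : j < (zone (nextZones E x s l) K).length := by
            rw [hzone, List.length_replicate]
            omega
          have h2 := zoneDigit_zoneStart_add h1
          rw [hstart, hzone, List.getD_eq_getElem _ _ (by rw [hzone] at h1; exact h1),
            List.getElem_replicate] at h2
          rw [h2]
          exact le_top
        · rw [zoneDigit_of_length_le hi']
          exact bot_le
    · have hz : zone l K = [false] := by
        by_contra hz
        rw [demand_of_bodd_of_ne hl hlen hb hz] at hdem
        simp at hdem
      obtain ⟨v, w, -, -, hvw⟩ :=
        mem_blockPattern ((demand_of_bodd_of_eq hb hz).symm.trans hdem)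
      rw [hvw] at hzone
      have h1 := zoneDigit_zoneStart_add (l := l) (k := K) (i := 0) (by simp [hz])
      have h2 := zoneDigit_zoneStart_add (l := nextZones E x s l) (k := K) (i := 0)
        (by simp [hzone, twoBlocks])
      rw [hz] at h1
      rw [hzone, hstart] at h2
      exact truncValue_le_of_lex hpre (by simpa using h1) (by simpa [twoBlocks] using h2) n
  · have hKl : K = l.length := le_antisymm activeZone_le_length (not_lt.1 hlen)
    have hnil : zone l K = [] := by rw [zone, hKl]; simp
    rw [demand, if_pos hnil] at hdem
    refine truncValue_le_of_le (fun i => ?_) n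
    rcases lt_or_ge i (zoneStart l K) with hi | hi
    · exact (hpre i hi).le
    · rw [zoneDigit_of_length_le]
      · exact bot_le
      · rwa [zoneStart, hKl, List.take_length] at hi

end Step

/-! ### Stabilization of the zones -/

section Limit

variable {E : ℕ → ℕ → ℕ → Bool} {x k s₀ t : ℕ}

/-- From stage `s₀` on, the first `k` zones do not change. -/
def IsStable (E : ℕ → ℕ → ℕ → Bool) (x k s₀ : ℕ) : Prop :=
  ∀ t ≥ s₀, k ≤ activeZone E x t (zonesAt E x t)

theorem IsStable.lt_length (h : IsStable E x k s₀) (ht : s₀ < t) :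
    k < (zonesAt E x t).length := by
  obtain ⟨t, rfl⟩ := Nat.exists_eq_succ_of_ne_zero (Nat.ne_zero_of_lt ht)
  rw [Nat.succ_eq_add_one, zonesAt_succ, length_nextZones]
  exact Nat.lt_succ_of_le (h t (Nat.lt_succ_iff.1 ht))

theorem IsStable.take_eq (h : IsStable E x k s₀) (ht : s₀ ≤ t) :
    (zonesAt E x t).take k = (zonesAt E x s₀).take k := by
  induction t, ht using Nat.le_induction with
  | base => rfl
  | succ t ht ih => rw [zonesAt_succ, take_nextZones (h t ht), ih]

theorem IsStable.zoneStart_eq (h : IsStable E x k s₀) (ht : s₀ ≤ t) :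
    zoneStart (zonesAt E x t) k = zoneStart (zonesAt E x s₀) k := by
  rw [zoneStart, h.take_eq ht, zoneStart]

theorem IsStable.zone_succ_of_demand_eq_none (h : IsStable E x k s₀) (ht : s₀ ≤ t)
    (hd : demand E x t k (zonesAt E x t) = none) :
    zone (zonesAt E x (t + 1)) k = zone (zonesAt E x t) k := by
  rw [zonesAt_succ]
  exact zone_nextZones_of_lt (lt_activeZone_of_demand_eq_none (h t ht) hd)

theorem IsStable.activeZone_eq_of_demand (h : IsStable E x k s₀) (ht : s₀ ≤ t)
    (hd : (demand E x t k (zonesAt E x t)).isSome = true) :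
    activeZone E x t (zonesAt E x t) = k :=
  le_antisymm (activeZone_le hd) (h t ht)

theorem IsStable.zone_succ_of_demand (h : IsStable E x k s₀) (ht : s₀ ≤ t) {z : List Bool}
    (hd : demand E x t k (zonesAt E x t) = some z) : zone (zonesAt E x (t + 1)) k = z := by
  have ha := h.activeZone_eq_of_demand ht (by rw [hd]; rfl)
  have hz := zone_nextZones_activeZone (E := E) (x := x) (s := t) (l := zonesAt E x t)
  rw [ha, hd] at hz
  exact hz

/-- A zone which works against a program acts at most once after it has been opened for the last
time. -/
theorem IsStable.succ_of_bodd (h : IsStable E x k s₀) (hb : k.bodd = true) :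
    ∃ s₁, IsStable E x (k + 1) s₁ := by
  have hzl := isZoneList_zonesAt E x
  by_cases hact : ∃ t > s₀, activeZone E x t (zonesAt E x t) = k
  · obtain ⟨t₀, ht₀, hact⟩ := hact
    have hdone : ∀ t ≥ t₀ + 1, zone (zonesAt E x t) k ≠ [false] := by
      intro t ht
      induction t, ht using Nat.le_induction with
      | base =>
        have hd := demand_activeZone (E := E) (x := x) (s := t₀) (l := zonesAt E x t₀)
        rw [hact] at hd
        have hz : zone (zonesAt E x t₀) k = [false] := by
          by_contra hz
          rw [demand_of_bodd_of_ne (hzl t₀) (h.lt_length ht₀) hb hz] at hd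
          simp at hd
        rw [h.zone_succ_of_demand ht₀.le hd]
        obtain ⟨v, w, -, -, hvw⟩ := mem_blockPattern ((demand_of_bodd_of_eq hb hz).symm.trans hd)
        rw [hvw]
        simp [twoBlocks]
      | succ t ht ih =>
        have hs : s₀ < t := ht₀.trans ht
        rwa [h.zone_succ_of_demand_eq_none hs.le
          (demand_of_bodd_of_ne (hzl t) (h.lt_length hs) hb ih)]
    refine ⟨t₀ + 1, fun t ht => ?_⟩
    have hs : s₀ < t := ht₀.trans ht
    exact lt_activeZone_of_demand_eq_none (h t hs.le)
      (demand_of_bodd_of_ne (hzl t) (h.lt_length hs) hb (hdone t ht))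
  · push Not at hact
    exact ⟨s₀ + 1, fun t ht => lt_of_le_of_ne (h t (by omega)) (hact t (by omega)).symm⟩

theorem exists_isStable (hE : ∀ j < k, j.bodd = false → ¬ ∃ᶠ s in atTop, E x j.div2 s = true) :
    ∃ s₀, IsStable E x k s₀ := by
  induction k with
  | zero => exact ⟨0, fun t _ => Nat.zero_le _⟩
  | succ k ih =>
    obtain ⟨s₀, h⟩ := ih fun j hj => hE j (hj.trans (Nat.lt_succ_self k))
    cases hb : k.bodd
    · have hev := hE k (Nat.lt_succ_self k) hb
      rw [not_frequently, eventually_atTop] at hev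
      obtain ⟨s₁, hs₁⟩ := hev
      refine ⟨max (s₀ + 1) s₁, fun t ht => ?_⟩
      have ht₀ : s₀ < t := le_trans (le_max_left _ _) ht
      exact lt_activeZone_of_demand_eq_none (h t ht₀.le)
        (demand_of_not_event (isZoneList_zonesAt E x t) (h.lt_length ht₀) hb
          (by simpa using hs₁ t ((le_max_right _ _).trans ht)))
    · exact h.succ_of_bodd hb

/-! ### The limit of the construction -/

/-- If the event for the zone occurs infinitely often, then the zone becomes an arbitrarily long
block of ones. -/
theorem IsStable.eventually_replicate (h : IsStable E x k s₀) (hb : k.bodd = false)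
    (hE : ∃ᶠ s in atTop, E x k.div2 s = true) (n : ℕ) :
    ∀ᶠ t in atTop, ∃ m ≥ n, zone (zonesAt E x t) k = List.replicate m true := by
  have hzl := isZoneList_zonesAt E x
  have hact : ∀ t > s₀, E x k.div2 t = true → zone (zonesAt E x (t + 1)) k =
      List.replicate ((zonesAt E x t).flatten.length + 1) true := fun t ht hEt =>
    h.zone_succ_of_demand ht.le (demand_of_event (hzl t) (h.lt_length ht) hb hEt)
  have hlen : ∀ t > s₀, ∀ m, zone (zonesAt E x t) k = List.replicate m true →
      m ≤ (zonesAt E x t).flatten.length := fun t ht m hm => by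
    have := zoneStart_add_length_le (h.lt_length ht)
    rw [hm, List.length_replicate] at this
    omega
  have hpersist : ∀ n, ∀ t > s₀, (∃ m ≥ n, zone (zonesAt E x t) k = List.replicate m true) →
      ∀ t' ≥ t, ∃ m ≥ n, zone (zonesAt E x t') k = List.replicate m true := by
    intro n t ht hm t' ht'
    induction t', ht' using Nat.le_induction with
    | base => exact hm
    | succ t' ht' ih =>
      obtain ⟨m, hnm, hm⟩ := ih
      have hs : s₀ < t' := ht.trans_le ht'
      cases hEt : E x k.div2 t'
      · rw [h.zone_succ_of_demand_eq_none hs.le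
          (demand_of_not_event (hzl t') (h.lt_length hs) hb hEt)]
        exact ⟨m, hnm, hm⟩
      · exact ⟨_, by have := hlen t' hs m hm; omega, hact t' hs hEt⟩
  have hex : ∃ t > s₀, ∃ m ≥ n, zone (zonesAt E x t) k = List.replicate m true := by
    induction n with
    | zero =>
      obtain ⟨t, ht, hEt⟩ := (frequently_atTop.1 hE) (s₀ + 1)
      exact ⟨t + 1, by omega, _, Nat.zero_le _, hact t ht hEt⟩
    | succ n ih =>
      obtain ⟨t, ht, hm⟩ := ih
      obtain ⟨t', ht', hEt⟩ := (frequently_atTop.1 hE) t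
      obtain ⟨m, hnm, hm⟩ := hpersist n t ht hm t' ht'
      have hs : s₀ < t' := lt_of_lt_of_le ht ht'
      exact ⟨t' + 1, by omega, _, by have := hlen t' hs m hm; omega, hact t' hs hEt⟩
  obtain ⟨t, ht, hm⟩ := hex
  exact eventually_atTop.2 ⟨t, hpersist n t ht hm⟩

theorem finite_compl_of_frequently {S : Set ℕ}
    (hS : IsLimitSet (fun s => zoneDigit (zonesAt E x s)) S)
    (hE : ∃ a, ∃ᶠ s in atTop, E x a s = true) : Sᶜ.Finite := by
  classical
  -- All zones before the one for the least such `a` stabilize.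
  obtain ⟨s₀, h⟩ : ∃ s₀, IsStable E x (2 * Nat.find hE) s₀ := by
    refine exists_isStable fun j hj hb => Nat.find_min hE ?_
    have := Nat.bodd_add_div2 j
    simp only [hb, Bool.toNat_false] at this
    omega
  have hdiv : (2 * Nat.find hE).div2 = Nat.find hE := by simp [Nat.div2_val]
  refine (Set.finite_Iio (zoneStart (zonesAt E x s₀) (2 * Nat.find hE))).subset fun i hi => ?_
  by_contra hlt
  obtain ⟨j, rfl⟩ := Nat.exists_eq_add_of_le (not_lt.1 hlt)
  have hev := h.eventually_replicate (by simp) (by rw [hdiv]; exact Nat.find_spec hE) (j + 1)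
  obtain ⟨t, ⟨⟨m, hm, hz⟩, ht⟩, hst⟩ :=
    ((hev.and (eventually_ge_atTop s₀)).and (hS _)).exists
  refine hi (hst.1 ?_)
  have hj : j < (zone (zonesAt E x t) (2 * Nat.find hE)).length := by
    rw [hz, List.length_replicate]
    omega
  change zoneDigit (zonesAt E x t) _ = true
  rw [← h.zoneStart_eq ht, zoneDigit_zoneStart_add hj, hz,
    List.getD_eq_getElem _ _ (by rwa [hz] at hj), List.getElem_replicate]

/-- If no event occurs infinitely often, then the zone working against a total program finally
contains the block pattern. -/
theorem exists_eventually_twoBlocks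
    (hE : ∀ a, ¬ ∃ᶠ s in atTop, E x a s = true) {f : ℕ → ℕ} (hf : Computable f) :
    ∃ k p, ∀ᶠ t in atTop, zoneStart (zonesAt E x t) k = p ∧
      zone (zonesAt E x t) k = twoBlocks (f (p + 1)) (f (p + 1 + f (p + 1))) := by
  obtain ⟨c, hc⟩ := Nat.Partrec.Code.exists_code.1 (Partrec.nat_iff.1 hf.partrec)
  have hmem : ∀ n, f n ∈ c.eval n := fun n => by rw [hc]; simp
  let k := 2 * Encodable.encode c + 1
  have hb : k.bodd = true := by simp [k]
  have hdiv : Denumerable.ofNat Nat.Partrec.Code k.div2 = c := by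
    have : k.div2 = Encodable.encode c := by simp [k, Nat.div2_val]
    rw [this, Denumerable.ofNat_encode]
  obtain ⟨s₀, h⟩ : ∃ s₀, IsStable E x (k + 1) s₀ := exists_isStable fun j _ _ => hE _
  have hk : IsStable E x k s₀ := fun t ht => (Nat.le_succ k).trans (h t ht)
  have hlen : ∀ t > s₀, k < (zonesAt E x t).length := fun t ht => hk.lt_length ht
  set p := zoneStart (zonesAt E x s₀) k
  have hp : ∀ t ≥ s₀, zoneStart (zonesAt E x t) k = p := fun t ht => hk.zoneStart_eq ht
  obtain ⟨m₁, hm₁⟩ := Nat.Partrec.Code.evaln_complete.1 (hmem (p + 1))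
  obtain ⟨m₂, hm₂⟩ := Nat.Partrec.Code.evaln_complete.1 (hmem (p + 1 + f (p + 1)))
  refine ⟨k, p, ?_⟩
  filter_upwards [eventually_gt_atTop s₀, eventually_ge_atTop m₁, eventually_ge_atTop m₂]
    with t ht h1 h2
  refine ⟨hp t ht.le, ?_⟩
  rcases isZoneList_zonesAt E x t k (hlen t ht) with hz | ⟨hb', -⟩ | ⟨-, v, w, hv, hw, hz⟩
  · -- An idle zone would act now, but it is stable.
    exfalso
    have hd : (demand E x t k (zonesAt E x t)).isSome = true := by
      rw [demand_of_bodd_of_eq hb hz, hdiv, hp t ht.le, blockPattern,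
        Nat.Partrec.Code.evaln_mono h1 hm₁, Option.bind_some,
        Nat.Partrec.Code.evaln_mono h2 hm₂]
      rfl
    exact absurd (h t ht.le) (not_le.2 (Nat.lt_succ_of_le (activeZone_le hd)))
  · rw [hb] at hb'
    simp at hb'
  · rw [hdiv, hp t ht.le] at hv hw
    have hv' := Part.mem_unique hv (hmem (p + 1))
    subst hv'
    rw [hz, Part.mem_unique hw (hmem _)]

theorem getD_twoBlocks_zeros {v w i : ℕ} (hi : i < v) :
    (twoBlocks v w).getD (1 + i) false = false := by
  rw [twoBlocks, add_comm, List.getD_cons_succ,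
    List.getD_append _ _ _ _ (by simpa using hi)]
  simp [List.getD, hi]

theorem getD_twoBlocks_ones {v w i : ℕ} (hi : i < w) :
    (twoBlocks v w).getD (1 + v + i) false = true := by
  rw [twoBlocks, show 1 + v + i = v + i + 1 by omega, List.getD_cons_succ,
    List.getD_append_right _ _ _ _ (by simp)]
  simp [List.getD, hi]

theorem biHyperimmune_of_not_frequently {S : Set ℕ}
    (hS : IsLimitSet (fun s => zoneDigit (zonesAt E x s)) S)
    (hE : ∀ a, ¬ ∃ᶠ s in atTop, E x a s = true) : BiHyperimmune S := by
  refine biHyperimmune_of_blocks fun f hf => ?_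
  obtain ⟨k, p, hev⟩ := exists_eventually_twoBlocks hE hf
  have hlen : ∀ v w, (twoBlocks v w).length = 1 + v + w := fun v w => by
    simp [twoBlocks]
    omega
  refine ⟨p, fun i hi hmem => ?_, fun i hi => ?_⟩
  · obtain ⟨t, ⟨hp, hz⟩, ht⟩ := (hev.and (hS (p + 1 + i))).exists
    have hd := zoneDigit_zoneStart_add (l := zonesAt E x t) (k := k) (i := 1 + i)
      (by rw [hz, hlen]; omega)
    rw [hp, hz, getD_twoBlocks_zeros hi, ← add_assoc] at hd
    simp [ht.2 hmem] at hd
  · obtain ⟨t, ⟨hp, hz⟩, ht⟩ := (hev.and (hS (p + 1 + f (p + 1) + i))).exists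
    refine ht.1 ?_
    have hd := zoneDigit_zoneStart_add (l := zonesAt E x t) (k := k) (i := 1 + f (p + 1) + i)
      (by rw [hz, hlen]; omega)
    rwa [hp, hz, getD_twoBlocks_ones hi, ← add_assoc, ← add_assoc] at hd

end Limit

/-! ### The reduction and the index sets -/

/-- Every `Σ⁰₃` set reduces to the finite reals, with its complement going to the bi-hyperimmune
reals. -/
theorem exists_reduction {α : ℕ → ℝ} (ha : IsAcceptable α) {A : Set ℕ} (hA : IsSigma3 A) :
    ∃ g : ℕ → ℕ, Computable g ∧ ∀ x,
      (x ∈ A → FiniteReal (α (g x))) ∧ (x ∉ A → BiHyperimmuneReal (α (g x))) := by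
  classical
  obtain ⟨E₀, hE₀, hAE⟩ := hA.exists_event
  let E : ℕ → ℕ → ℕ → Bool := fun x a s => decide (E₀ x a s)
  have hE : Primrec fun p : ℕ × ℕ × ℕ => E p.1 p.2.1 p.2.2 := hE₀.decide
  have hAE' : ∀ x, x ∈ A ↔ ∃ a, ∃ᶠ s in atTop, E x a s = true := fun x => by
    simp only [hAE, E, decide_eq_true_iff]
  choose β hβ using fun x => exists_isDyadicApprox (F := fun s => zoneDigit (zonesAt E x s))
    fun s n => truncValue_nextZones_le (isZoneList_zonesAt E x s) n
  obtain ⟨g, hg, hgβ⟩ := ha.exists_computable (primrec_truncValue_zonesAt hE) hβ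
  refine ⟨g, hg, fun x => ?_⟩
  obtain ⟨S, hS, hlim⟩ := (hβ x).exists_limitSet
  have hlim' : IsLimitSet (fun s => zoneDigit (zonesAt E x s)) S := hlim.congr fun n => by
    filter_upwards [eventually_gt_atTop n] with s hs
    exact dyadicDigit_truncValue (fun s => zoneDigit (zonesAt E x s)) hs
  rw [hgβ]
  refine ⟨fun hx => ⟨S, hS, fun h => h.2 ?_⟩, fun hx => ⟨S, hS, ?_⟩⟩
  · exact finite_compl_of_frequently hlim' ((hAE' x).1 hx)
  · refine biHyperimmune_of_not_frequently hlim' ?_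
    rw [hAE' x] at hx
    push Not at hx
    simpa using hx

/-- The index set of a property of sets is `Π⁰₃`-complete if its failure is `Σ⁰₃` on uniform
limits, no finite or cofinite set has the property, and all bi-hyperimmune sets do. -/
theorem isPi3Complete_indexSet {α : ℕ → ℝ} (hu : IsUniversal α) (ha : IsAcceptable α)
    {P : Set ℕ → Prop} (hP : ∀ S, P S → S.Infinite ∧ Sᶜ.Infinite)
    (hbi : ∀ S, BiHyperimmune S → P S)
    (hsigma : ∀ D S, IsUniformLimit D S → IsSigma3 {e | ¬ P (S e)}) :
    IsPi3Complete {e | ∃ S, IsBinaryExpansion (α e) S ∧ P S} := by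
  constructor
  · obtain ⟨D, S, hD, hS⟩ := hu.exists_isUniformLimit
    have h := hsigma D S hD
    have heq : {e | ¬ P (S e)} = {e | ∃ S, IsBinaryExpansion (α e) S ∧ P S}ᶜ := by
      ext e
      exact (not_congr (exists_expansion_iff hP (hS e))).symm
    rwa [heq] at h
  · intro X hX
    obtain ⟨g, hg, hred⟩ := exists_reduction ha hX
    refine ⟨g, hg, fun x => ⟨fun hx => ?_, fun hx => ?_⟩⟩
    · obtain ⟨S, hS, hS'⟩ := (hred x).2 (fun h => h hx)
      exact ⟨S, hS, hbi S hS'⟩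
    · by_contra hxX
      exact not_exists_expansion_of_finiteReal hP ((hred x).1 hxX) hx

end LeftRE

theorem mainTheorem7 (α : ℕ → ℝ) (hu : LeftRE.IsUniversal α) (ha : LeftRE.IsAcceptable α) :
    (∀ A : Set ℕ, LeftRE.IsSigma3 A →
      ∃ g : ℕ → ℕ, Computable g ∧ ∀ x,
        (x ∈ A → LeftRE.FiniteReal (α (g x))) ∧
        (x ∉ A → LeftRE.BiHyperimmuneReal (α (g x)))) ∧
    LeftRE.IsPi3Complete {e | LeftRE.ImmuneReal (α e)} ∧
    LeftRE.IsPi3Complete {e | LeftRE.HyperimmuneReal (α e)} ∧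
    LeftRE.IsPi3Complete {e | LeftRE.BiImmuneReal (α e)} ∧
    LeftRE.IsPi3Complete {e | LeftRE.BiHyperimmuneReal (α e)} :=
  ⟨fun _ hA => LeftRE.exists_reduction ha hA,
    LeftRE.isPi3Complete_indexSet hu ha (fun _ h => h.infinite_and_compl)
      (fun _ h => h.1.immune) fun _ _ h => h.isSigma3_not_immune,
    LeftRE.isPi3Complete_indexSet hu ha (fun _ h => h.immune.infinite_and_compl)
      (fun _ h => h.1) fun _ _ h => h.isSigma3_not_hyperimmune,
    LeftRE.isPi3Complete_indexSet hu ha (fun _ h => h.1.infinite_and_compl)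
      (fun _ h => ⟨h.1.immune, h.2.immune⟩) fun _ _ h => h.isSigma3_not_biImmune,
    LeftRE.isPi3Complete_indexSet hu ha (fun _ h => h.1.immune.infinite_and_compl)
      (fun _ h => h) fun _ _ h => h.isSigma3_not_biHyperimmune⟩
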